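/- Let $(\mathbb X,\mathcal X)$ be a measurable space whose diagonal $\{(x,x):x\in\mathbb X\}$ is measurable in the product $\sigma$-algebra, $\pi_0$ a probability measure on $\mathcal X$, $K$ a Markov kernel on $\mathbb X$, $L\ge 0$, and for all $n\ge 0$ let $g_n^0,\dots,g_n^L:\mathbb X\to\mathbb R$ be bounded and measurable with $g_n:=g_n^L>0$. Put $g_n^{-1}:=0$ and $\Delta g_n^\ell:=g_n^\ell-g_n^{\ell-1}$. Assume that $\pi_0$ and all $K(x,\cdot)$ give mass zero to every single point, or else that $\Delta g_n^\ell\ge 0$ for all $n\geq 0$ and $0\le\ell\le L$ (which is automatic for $L=0$). Let $\mathcal B(\mathbb X)$ be the set of bounded measurable functions $\mathbb X\to\mathbb R$, and write $K(\varphi)(x)=\int\varphi(y)\,K(x,\mathrm dy)$, $\widehat\pi_n(\varphi)=\pi_n(g_n\varphi)/\pi_n(g_n)$ and $\pi_{n+1}(\varphi)=\widehat\pi_n(K(\varphi))$ for $n\ge0$. Let $c_0,\dots,c_L\ge 1$ be integers. For every integer $N\ge1$ put $N_\ell=c_\ell N$ and $S(N)=\sum_{\ell=0}^L N_\ell$,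 and partition $\{1,\dots,S(N)\}$ into consecutive blocks $P^N_0,\dots,P^N_L$ with $|P_\ell^N|=N_\ell$. On one probability space let, for every $N$, a run of the following multilevel bootstrap particle filter be given, with an arbitrary joint law of the runs for different $N$. Initially $\xi_0^1,\dots,\xi_0^{S(N)}$ are independent with law $\pi_0$, and $w^i_0=1$. For $n\ge0$: (i) $\widetilde w_n^i=N_\ell^{-1}\Delta g_n^\ell(\xi_n^i)\,w_n^i$ for $i\in P^N_\ell$; (ii) given the past, $\widehat\xi_n^1,\dots,\widehat\xi_n^{S(N)}$ are independent with law $\sum_j|\widetilde w^j_n|\delta_{\xi^j_n}\big/\sum_j|\widetilde w_n^j|$ (with no requirement where all $\widetilde w_n^j$ vanish), and $\widehat w_n^i=\mathrm{sgn}\big(\sum_j\widetilde w_n^j\,\mathbb I[\widehat\xi_n^i=\xi_n^j]\big)$; (iii) given the past, $\xi^1_{n+1},\dots,\xi^{S(N)}_{n+1}$ are independent with $\xi^i_{n+1}\sim K(\widehat\xi^i_n,\cdot)$, and $w^i_{n+1}=\widehat w^i_n$. Let $\gamma^N_{n,\ell}=N_\ell^{-1}\sum_{i\in P^N_\ell}w_n^i\delta_{\xi_n^i}$,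 a random signed measure, and let $|\gamma^N_{n,\ell}|$ be its total variation measure. Then for all $\varphi\in\mathcal B(\mathbb X)$, $n\ge0$ and $0\le\ell\le L$, almost surely as $N\to\infty$, $$\gamma^N_{n,\ell}(\varphi)\to\gamma_n(\varphi)\qquad\text{and}\qquad|\gamma^N_{n,\ell}|(\varphi)\to\eta_n(\varphi),$$ where $\gamma_0=\eta_0=\pi_0$ and, for $n\ge0$, $$\gamma_{n+1}(\varphi)=\pi_{n+1}(\varphi)\,\widehat\gamma_n(1),\qquad \eta_{n+1}(\varphi)=\widehat\eta_n(K(\varphi)),$$ $$\widehat\gamma_n(\varphi)=\frac{\sum_{\ell=0}^L\gamma_n(\Delta g_n^\ell\varphi)}{\sum_{\ell=0}^L\eta_n(|\Delta g_n^\ell|)},\qquad \widehat\eta_n(\varphi)=\frac{\sum_{\ell=0}^L\eta_n(|\Delta g_n^\ell|\varphi)}{\sum_{\ell=0}^L\eta_n(|\Delta g_n^\ell|)}.$$ -/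

import Mathlib

open MeasureTheory ProbabilityTheory Filter Topology

noncomputable section

namespace MLBPF

variable {X : Type*} [MeasurableSpace X] {L : ℕ}

/-! ### The model -/

/-- `Δg^ℓ = g^ℓ - g^{ℓ-1}` for `ℓ = 0, …, L`, with the convention `g^{-1} = 0`;
`g : Fin (L + 1) → X → ℝ` lists the likelihood approximations at one fixed time. -/
def levelDiff (g : Fin (L + 1) → X → ℝ) (ℓ : Fin (L + 1)) : X → ℝ :=
  Fin.cases (motive := fun _ => X → ℝ) (g 0) (fun k => g k.succ - g k.castSucc) ℓ

/-- The integral operator of a kernel, `K(φ)(x) = ∫ φ(y) K(x, dy)`. -/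
def kernelOp (K : Kernel X X) (φ : X → ℝ) : X → ℝ := fun x => ∫ y, φ y ∂(K x)

/-- Bayes update of the measure `μ` with the likelihood `h`: the measure `φ ↦ μ(h φ) / μ(h)`. -/
def bayesUpdate (μ : Measure X) (h : X → ℝ) : Measure X :=
  (∫⁻ x, ENNReal.ofReal (h x) ∂μ)⁻¹ • μ.withDensity (fun x => ENNReal.ofReal (h x))

/-- The exact prediction filter `π_n`: `π_{n+1} = π̂_n K`, where `π̂_n(φ) = π_n(g_n φ) / π_n(g_n)`
and `g_n = g_n^L` is the exact likelihood. -/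
def predFilter (π₀ : Measure X) (K : Kernel X X) (g : ℕ → Fin (L + 1) → X → ℝ) : ℕ → Measure X
  | 0 => π₀
  | n + 1 => (bayesUpdate (predFilter π₀ K g n) (g n (Fin.last L))).bind K

/-! ### The limits -/

/-- `η ↦ η̂`, where `η̂(φ) = (∑_ℓ η(|Δg^ℓ| φ)) / (∑_ℓ η(|Δg^ℓ|))`. -/
def etaUpdate (g : Fin (L + 1) → X → ℝ) (η : (X → ℝ) → ℝ) : (X → ℝ) → ℝ := fun φ =>
  (∑ ℓ, η (fun x => |levelDiff g ℓ x| * φ x)) / ∑ ℓ, η (fun x => |levelDiff g ℓ x|)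

/-- `(γ, η) ↦ γ̂`, where `γ̂(φ) = (∑_ℓ γ(Δg^ℓ φ)) / (∑_ℓ η(|Δg^ℓ|))`. -/
def gammaUpdate (g : Fin (L + 1) → X → ℝ) (γ η : (X → ℝ) → ℝ) : (X → ℝ) → ℝ := fun φ =>
  (∑ ℓ, γ (fun x => levelDiff g ℓ x * φ x)) / ∑ ℓ, η (fun x => |levelDiff g ℓ x|)

/-- `η_n`, as an integration functional: `η_0 = π_0` and `η_{n+1}(φ) = η̂_n(K(φ))`. -/
def eta (π₀ : Measure X) (K : Kernel X X) (g : ℕ → Fin (L + 1) → X → ℝ) : ℕ → (X → ℝ) → ℝ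
  | 0 => fun φ => ∫ x, φ x ∂π₀
  | n + 1 => fun φ => etaUpdate (g n) (eta π₀ K g n) (kernelOp K φ)

/-- `γ_n`, as an integration functional: `γ_0 = π_0` and `γ_{n+1}(φ) = π_{n+1}(φ) γ̂_n(1)`. -/
def gamma (π₀ : Measure X) (K : Kernel X X) (g : ℕ → Fin (L + 1) → X → ℝ) : ℕ → (X → ℝ) → ℝ
  | 0 => fun φ => ∫ x, φ x ∂π₀
  | n + 1 => fun φ => (∫ x, φ x ∂(predFilter π₀ K g (n + 1))) *
      gammaUpdate (g n) (gamma π₀ K g n) (eta π₀ K g n) (fun _ => 1)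

/-! ### The particle system -/

/-- The particle indices `1, …, S(N)`, sorted by level: `⟨ℓ, k⟩` is the `k`-th of the
`N_ℓ = c_ℓ N` elements of the block `P_ℓ^N`. -/
abbrev Idx (c : Fin (L + 1) → ℕ) (N : ℕ) : Type := (ℓ : Fin (L + 1)) × Fin (c ℓ * N)

variable {c : Fin (L + 1) → ℕ} {N : ℕ}

/-- The updated weights `w̃^i = N_ℓ^{-1} Δg^ℓ(ξ^i) w^i` for `i ∈ P_ℓ^N`, from the
positions `x = (ξ^i)` and the weights `w = (w^i)`. -/
def updatedWeight (g : Fin (L + 1) → X → ℝ) (x : Idx c N → X) (w : Idx c N → ℝ) :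
    Idx c N → ℝ := fun i =>
  ((c i.1 * N : ℕ) : ℝ)⁻¹ * levelDiff g i.1 (x i) * w i

/-- The function `w̃(ξ) = ∑_i w̃^i 𝟙[ξ = ξ^i]`. -/
def weightAt (x : Idx c N → X) (v : Idx c N → ℝ) (y : X) : ℝ :=
  ∑ i, Set.indicator {x i} (fun _ => v i) y

/-- The weights `w_n^i`, from the particle positions `x n i = ξ_n^i` and the resampled
positions `y n i = ξ̂_n^i`: `w_0^i = 1` and `w_{n+1}^i = ŵ_n^i = sgn(w̃_n(ξ̂_n^i))`. -/
def weight (g : ℕ → Fin (L + 1) → X → ℝ) (x y : ℕ → Idx c N → X) : ℕ → Idx c N → ℝ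
  | 0 => fun _ => 1
  | n + 1 => fun i =>
      Real.sign (weightAt (x n) (updatedWeight (g n) (x n) (weight g x y n)) (y n i))

/-- The weights `w̃_n^i` along a trajectory of the particle system. -/
def tildeWeight (g : ℕ → Fin (L + 1) → X → ℝ) (x y : ℕ → Idx c N → X) (n : ℕ) : Idx c N → ℝ :=
  updatedWeight (g n) (x n) (weight g x y n)

section Random

variable {Ω : Type*}

/-- The `σ`-algebra generated by the `ξ_q^i` with `q ≤ n` and the `ξ̂_p^i` with `p < n`. -/
@[reducible] def history (ξ ξh : ℕ → Idx c N → Ω → X) (n : ℕ) : MeasurableSpace Ω :=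
  (⨆ q ≤ n, ⨆ i, MeasurableSpace.comap (ξ q i) inferInstance) ⊔
    (⨆ p < n, ⨆ i, MeasurableSpace.comap (ξh p i) inferInstance)

/-- The `σ`-algebra generated by the `ξ_q^i` and the `ξ̂_q^i` with `q ≤ n`. -/
@[reducible] def historyHat (ξ ξh : ℕ → Idx c N → Ω → X) (n : ℕ) : MeasurableSpace Ω :=
  (⨆ q ≤ n, ⨆ i, MeasurableSpace.comap (ξ q i) inferInstance) ⊔
    (⨆ p ≤ n, ⨆ i, MeasurableSpace.comap (ξh p i) inferInstance)

variable [MeasurableSpace Ω]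

/-- `ξ q i` (particles) and `ξh q i` (resampled particles) form a run of the multilevel bootstrap
particle filter with sample size parameter `N`, on the probability space `(Ω, P)`. -/
structure IsRun (P : Measure Ω) (π₀ : Measure X) (K : Kernel X X)
    (g : ℕ → Fin (L + 1) → X → ℝ) (ξ ξh : ℕ → Idx c N → Ω → X) : Prop where
  measurable_particle : ∀ n i, Measurable (ξ n i)
  measurable_resampled : ∀ n i, Measurable (ξh n i)
  /-- Initialisation: the `ξ_0^i` are independent with law `π₀`. -/
  init_indep : iIndepFun (ξ 0) P
  init_law : ∀ i, P.map (ξ 0 i) = π₀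
  /-- Resampling: given the past, the `ξ̂_n^i` are independent, each with law
  `∑_j |w̃_n^j| δ_{ξ_n^j} / ∑_j |w̃_n^j|`, wherever this is defined
  (nothing is required where all `w̃_n^j` vanish). -/
  resample : ∀ (n : ℕ) (A : Idx c N → Set X), (∀ i, MeasurableSet (A i)) →
    ∀ᵐ ω ∂P, 0 < ∑ j, |tildeWeight g (fun q i => ξ q i ω) (fun q i => ξh q i ω) n j| →
      (P⟦⋂ i, ξh n i ⁻¹' A i | history ξ ξh n⟧) ω =
        ∏ i, (∑ j, |tildeWeight g (fun q i => ξ q i ω) (fun q i => ξh q i ω) n j| *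
            (A i).indicator (fun _ => (1 : ℝ)) (ξ n j ω)) /
          ∑ j, |tildeWeight g (fun q i => ξ q i ω) (fun q i => ξh q i ω) n j|
  /-- Mutation: given the past, the `ξ_{n+1}^i` are independent with laws `K(ξ̂_n^i, ·)`. -/
  mutate : ∀ (n : ℕ) (A : Idx c N → Set X), (∀ i, MeasurableSet (A i)) →
    ∀ᵐ ω ∂P, (P⟦⋂ i, ξ (n + 1) i ⁻¹' A i | historyHat ξ ξh n⟧) ω =
      ∏ i, (K (ξh n i ω)).real (A i)

end Random

/-! ### The empirical measures, from the positions `x` and weights `w` at one fixed time -/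

/-- The signed measure `γ^N_{n,ℓ} = N_ℓ^{-1} ∑_{i ∈ P_ℓ^N} w^i δ_{ξ^i}`. -/
def empSigned (x : Idx c N → X) (w : Idx c N → ℝ) (ℓ : Fin (L + 1)) : SignedMeasure X :=
  ((c ℓ * N : ℕ) : ℝ)⁻¹ •
    ∑ k : Fin (c ℓ * N), w ⟨ℓ, k⟩ • (Measure.dirac (x ⟨ℓ, k⟩)).toSignedMeasure

/-- `γ^N_{n,ℓ}(φ) = N_ℓ^{-1} ∑_{i ∈ P_ℓ^N} w^i φ(ξ^i)`. -/
def empGamma (x : Idx c N → X) (w : Idx c N → ℝ) (ℓ : Fin (L + 1)) (φ : X → ℝ) : ℝ :=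
  ((c ℓ * N : ℕ) : ℝ)⁻¹ * ∑ k : Fin (c ℓ * N), w ⟨ℓ, k⟩ * φ (x ⟨ℓ, k⟩)

/-- `|γ^N_{n,ℓ}|(φ)`, the integral against the total variation measure of `γ^N_{n,ℓ}`. -/
def empAbsGamma (x : Idx c N → X) (w : Idx c N → ℝ) (ℓ : Fin (L + 1)) (φ : X → ℝ) : ℝ :=
  ∫ y, φ y ∂(empSigned x w ℓ).totalVariation

end MLBPF

end

/-! The proof is an induction on `n` for two statements at once: the block means of `w_n φ` converge
to `γ_n(φ)`, and those of `|w_n| φ` to `η_n(φ)`. Writing `T` for `id` or `|·|` handles both with one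
argument (`ae_tendsto_step`).

Resampling and mutation are conditionally independent draws, so Hoeffding's inequality, applied
under the conditional product law, bounds the deviation of each block mean from its conditional mean
by a Gaussian tail in `N`. The tails are summable, and Borel–Cantelli gives almost sure convergence
to zero; hence the joint law of the runs for different `N` plays no role. The conditional mean after
resampling is `(∑ |w̃^j| T(sgn w̃(ξ^j)) Kφ(ξ^j)) / ∑ |w̃^j|`. If positions are distinct or all
`w̃^j` are nonnegative, then `|w̃^j| sgn w̃(ξ^j) = w̃^j` (`abs_mul_sign_weightAt`), so the numerator
is `∑ T(w̃^j) Kφ(ξ^j)`. Sorted by levels it is a sum of block means with test functions `T(Δg^ℓ)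
Kφ`, to which the induction hypothesis applies.

The limiting denominator is positive, because `∑ |Δg^ℓ| ≥ g^L > 0` and `η_n` is a probability
measure; thus eventually not all `w̃^j` vanish. The limits obtained are `γ̂_n(Kφ)` and `η̂_n(Kφ)`.
The first equals `π_{n+1}(φ) γ̂_n(1)`, since `γ_n` is a multiple of `π_n` and the `Δg^ℓ` telescope
to `g^L` (`gamma_succ`).

The same dichotomy, distinct atoms or nonnegative weights, turns the total variation measure into
the point masses with weights `|w|` (`empAbsGamma_eq`). Distinctness holds almost surely when the
initial law and the kernel are atomless. -/

noncomputable section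

namespace MLBPF

/-! ### Concentration under conditional product laws, and Borel–Cantelli -/

section Tools

variable {Ω E X ι : Type*}

/-- Two-sided Hoeffding inequality for bounded independent variables. -/
theorem hoeffding_abs [MeasurableSpace Ω] {μ : Measure Ω} [IsProbabilityMeasure μ]
    {Y : ι → Ω → ℝ} (hY : ∀ i, Measurable (Y i)) (hi : iIndepFun Y μ) {C : ℝ} (hC : 0 < C)
    (hb : ∀ i ω, |Y i ω| ≤ C) (s : Finset ι) {ε : ℝ} (hε : 0 ≤ ε) :
    μ {ω | ε * s.card ≤ |∑ i ∈ s, (Y i ω - ∫ ω', Y i ω' ∂μ)|} ≤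
      ENNReal.ofReal (2 * Real.exp (-(ε ^ 2 * s.card / (2 * C ^ 2)))) := by
  -- Hoeffding's lemma on `[-C, C]`: the variance proxy is the squared half-length, that is `C ^ 2`.
  have hsub : ∀ i, HasSubgaussianMGF (fun ω => Y i ω - ∫ ω', Y i ω' ∂μ)
      ((‖C - -C‖₊ / 2) ^ 2) μ := fun i =>
    hasSubgaussianMGF_of_mem_Icc (hY i).aemeasurable (ae_of_all _ fun ω => abs_le.mp (hb i ω))
  have hind : iIndepFun (fun i ω => Y i ω - ∫ ω', Y i ω' ∂μ) μ :=
    hi.comp (fun i x => x - ∫ ω', Y i ω' ∂μ) fun i => measurable_id.sub_const _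
  have hind' : iIndepFun (fun i ω => -(Y i ω - ∫ ω', Y i ω' ∂μ)) μ :=
    hind.comp (fun i x => -x) fun i => measurable_id.neg
  have hpos : 0 ≤ ε * s.card := by positivity
  have hexp : Real.exp (-(ε * s.card) ^ 2 / (2 * ((∑ i ∈ s, (‖C - -C‖₊ / 2) ^ 2 : NNReal) : ℝ))) =
      Real.exp (-(ε ^ 2 * s.card / (2 * C ^ 2))) := by
    congr 1
    have : ‖C - -C‖ = 2 * C := by
      rw [Real.norm_eq_abs, abs_of_pos (by linarith)]; ring
    simp only [Finset.sum_const, nsmul_eq_mul, NNReal.coe_mul, NNReal.coe_natCast, NNReal.coe_pow,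
      NNReal.coe_div, coe_nnnorm, this, NNReal.coe_ofNat]
    rcases Nat.eq_zero_or_pos s.card with h | h
    · simp [h]
    · have : (0 : ℝ) < s.card := by exact_mod_cast h
      field_simp
  have h1 := HasSubgaussianMGF.measure_sum_ge_le_of_iIndepFun hind (s := s)
    (fun i _ => hsub i) hpos
  have h2 := HasSubgaussianMGF.measure_sum_ge_le_of_iIndepFun hind' (s := s)
    (fun i _ => (hsub i).neg) hpos
  push_cast at h1 h2 hexp
  rw [hexp] at h1 h2
  rw [← ofReal_measureReal]
  refine ENNReal.ofReal_le_ofReal ?_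
  refine (measureReal_mono (s₂ := {ω | ε * s.card ≤ ∑ i ∈ s, (Y i ω - ∫ ω', Y i ω' ∂μ)} ∪
    {ω | ε * s.card ≤ ∑ i ∈ s, -(Y i ω - ∫ ω', Y i ω' ∂μ)}) ?_).trans
      ((measureReal_union_le _ _).trans (by linarith))
  intro ω hω
  simp only [Set.mem_ofPred_eq, Set.mem_union, Finset.sum_neg_distrib] at hω ⊢
  exact le_abs.mp hω

/-- The kernel of product measures. -/
def piKernel [Fintype ι] [MeasurableSpace E] [MeasurableSpace X] (κ : ι → Kernel E X)
    [∀ i, IsMarkovKernel (κ i)] : Kernel E (ι → X) where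
  toFun e := Measure.pi fun i => κ i e
  measurable' := by
    refine Measurable.measure_of_isPiSystem_of_isProbabilityMeasure generateFrom_pi.symm
      isPiSystem_pi ?_
    rintro _ ⟨A, hA, rfl⟩
    simp only [Measure.pi_pi]
    exact Finset.measurable_prod _ fun i _ =>
      (κ i).measurable_coe (hA i (Set.mem_univ i))

instance [Fintype ι] [MeasurableSpace E] [MeasurableSpace X] (κ : ι → Kernel E X)
    [∀ i, IsMarkovKernel (κ i)] : IsMarkovKernel (piKernel κ) :=
  ⟨fun e => by change IsProbabilityMeasure (Measure.pi fun i => κ i e); infer_instance⟩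

theorem piKernel_apply [Fintype ι] [MeasurableSpace E] [MeasurableSpace X] (κ : ι → Kernel E X)
    [∀ i, IsMarkovKernel (κ i)] (e : E) : piKernel κ e = Measure.pi fun i => κ i e := rfl

/-- A family `Z` whose rectangle probabilities are, on `G`, given by product kernels
disintegrates along these kernels. -/
theorem map_prodMk_eq_compProd [Fintype ι] [MeasurableSpace Ω] [MeasurableSpace E]
    [MeasurableSpace X] {P : Measure Ω} [IsFiniteMeasure P] {H : Ω → E} (hH : Measurable H)
    {Z : ι → Ω → X} (hZ : ∀ i, Measurable (Z i)) {G : Set Ω}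
    (κ : ι → Kernel E X) [∀ i, IsMarkovKernel (κ i)]
    (h : ∀ B, MeasurableSet B → ∀ A : ι → Set X, (∀ i, MeasurableSet (A i)) →
      P (H ⁻¹' B ∩ (⋂ i, Z i ⁻¹' A i) ∩ G) = ∫⁻ ω in H ⁻¹' B ∩ G, ∏ i, κ i (H ω) (A i) ∂P) :
    (P.restrict G).map (fun ω => (H ω, fun i => Z i ω)) =
      ((P.restrict G).map H) ⊗ₘ piKernel κ := by
  have hZ' : Measurable fun ω i => Z i ω := measurable_pi_lambda _ hZ
  refine Measure.ext_prod fun {B T} hB hT => ?_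
  -- For fixed `B` both sides are finite measures in the second coordinate, so agreement on the
  -- π-system of rectangles extends to all measurable sets.
  have key : ((P.restrict G).restrict (H ⁻¹' B)).map (fun ω i => Z i ω) =
      (((P.restrict G).restrict (H ⁻¹' B)).map H).bind (piKernel κ) := by
    refine ext_of_generate_finite _ generateFrom_pi.symm isPiSystem_pi ?_ ?_
    · rintro _ ⟨A, hA, rfl⟩
      have hA' : ∀ i, MeasurableSet (A i) := fun i => hA i (Set.mem_univ i)
      have hAm : MeasurableSet (Set.univ.pi A) := MeasurableSet.univ_pi hA'
      have hs : (fun ω i => Z i ω) ⁻¹' Set.univ.pi A = ⋂ i, Z i ⁻¹' A i := by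
        ext ω; simp [Set.mem_pi]
      rw [Measure.map_apply hZ' hAm, Measure.bind_apply hAm (piKernel κ).aemeasurable, hs,
        Measure.restrict_restrict (hH hB),
        Measure.restrict_apply (hs ▸ hZ' hAm), lintegral_map ((piKernel κ).measurable_coe hAm) hH]
      simp only [piKernel_apply, Measure.pi_pi]
      rw [← h B hB A hA']
      congr 1
      ext ω; simp only [Set.mem_inter_iff]; tauto
    · rw [Measure.map_apply hZ' MeasurableSet.univ,
        Measure.bind_apply MeasurableSet.univ (piKernel κ).aemeasurable]
      simp [Measure.map_apply hH MeasurableSet.univ]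
  rw [Measure.map_apply (hH.prodMk hZ') (hB.prod hT), Measure.compProd_apply_prod hB hT,
    setLIntegral_map hB ((piKernel κ).measurable_coe hT) hH]
  have := DFunLike.congr_fun key T
  rw [Measure.map_apply hZ' hT, Measure.bind_apply hT (piKernel κ).aemeasurable,
    lintegral_map ((piKernel κ).measurable_coe hT) hH, Measure.restrict_apply (hZ' hT)] at this
  rw [← this]
  congr 1
  ext ω; simp only [Set.mem_preimage, Set.mem_prod, Set.mem_inter_iff]; tauto

/-- If on `G` the conditional law of `Z` given `H` is a product of kernels, then a bound for the
sections of `S` which is uniform in the past bounds the probability that `(H, Z) ∈ S` on `G`. -/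
theorem measure_le_of_pi_le [Fintype ι] [MeasurableSpace Ω] [MeasurableSpace E]
    [MeasurableSpace X] {P : Measure Ω} [IsProbabilityMeasure P] {H : Ω → E} (hH : Measurable H)
    {Z : ι → Ω → X} (hZ : ∀ i, Measurable (Z i)) {G : Set Ω}
    (κ : ι → Kernel E X) [∀ i, IsMarkovKernel (κ i)]
    (h : ∀ B, MeasurableSet B → ∀ A : ι → Set X, (∀ i, MeasurableSet (A i)) →
      P (H ⁻¹' B ∩ (⋂ i, Z i ⁻¹' A i) ∩ G) = ∫⁻ ω in H ⁻¹' B ∩ G, ∏ i, κ i (H ω) (A i) ∂P)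
    {S : Set (E × (ι → X))} (hS : MeasurableSet S) {b : ENNReal}
    (hb : ∀ e, Measure.pi (fun i => κ i e) {z | (e, z) ∈ S} ≤ b) :
    P ({ω | (H ω, fun i => Z i ω) ∈ S} ∩ G) ≤ b := by
  have hZ' : Measurable fun ω i => Z i ω := measurable_pi_lambda _ hZ
  have h1 := DFunLike.congr_fun (map_prodMk_eq_compProd hH hZ κ h) S
  have hm := hH.prodMk hZ'
  rw [Measure.map_apply hm hS, Measure.restrict_apply (hm hS), Measure.compProd_apply hS,
    lintegral_map (Kernel.measurable_kernel_prodMk_left hS) hH] at h1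
  refine h1.le.trans ((lintegral_mono fun ω => hb (H ω)).trans ?_)
  rw [lintegral_const]
  exact mul_le_of_le_one_right' (prob_le_one.trans' (Measure.restrict_apply_le _ _))

/-- Hoeffding's inequality under a conditional product law. -/
theorem hoeffding_of_pi [Fintype ι] [MeasurableSpace Ω] [MeasurableSpace E]
    [MeasurableSpace X] {P : Measure Ω} [IsProbabilityMeasure P] {H : Ω → E} (hH : Measurable H)
    {Z : ι → Ω → X} (hZ : ∀ i, Measurable (Z i)) {G : Set Ω}
    (κ : ι → Kernel E X) [∀ i, IsMarkovKernel (κ i)]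
    (h : ∀ B, MeasurableSet B → ∀ A : ι → Set X, (∀ i, MeasurableSet (A i)) →
      P (H ⁻¹' B ∩ (⋂ i, Z i ⁻¹' A i) ∩ G) = ∫⁻ ω in H ⁻¹' B ∩ G, ∏ i, κ i (H ω) (A i) ∂P)
    {f : ι → E → X → ℝ} (hf : ∀ i, Measurable fun p : E × X => f i p.1 p.2) {C : ℝ} (hC : 0 < C)
    (hb : ∀ i e x, |f i e x| ≤ C) (s : Finset ι) {ε : ℝ} (hε : 0 ≤ ε) :
    P ({ω | ε * s.card ≤ |∑ i ∈ s, (f i (H ω) (Z i ω) - ∫ x, f i (H ω) x ∂(κ i (H ω)))|} ∩ G) ≤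
      ENNReal.ofReal (2 * Real.exp (-(ε ^ 2 * s.card / (2 * C ^ 2)))) := by
  refine measure_le_of_pi_le hH hZ κ h (S := {p | ε * s.card ≤
    |∑ i ∈ s, (f i p.1 (p.2 i) - ∫ x, f i p.1 x ∂(κ i p.1))|}) ?_ ?_
  · refine measurableSet_le measurable_const (continuous_abs.measurable.comp
      (Finset.measurable_sum _ fun i _ => ?_))
    refine ((hf i).comp (measurable_fst.prodMk ((measurable_pi_apply i).comp
      measurable_snd))).sub ?_
    have : StronglyMeasurable fun e => ∫ x, f i e x ∂(κ i e) :=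
      StronglyMeasurable.integral_kernel_prod_right (f := fun e x => f i e x)
        (hf i).stronglyMeasurable
    exact this.measurable.comp measurable_fst
  · intro e
    have hfe : ∀ i, Measurable (f i e) := fun i => (hf i).comp measurable_prodMk_left
    have hI : ∀ i, ∫ z : ι → X, f i e (z i) ∂(Measure.pi fun i => κ i e) =
        ∫ x, f i e x ∂(κ i e) := fun i => by
      have hp := (measurePreserving_eval (fun i => κ i e) i).map_eq
      conv_rhs => rw [← hp]
      exact (integral_map (measurable_pi_apply i).aemeasurable
        (hfe i).aestronglyMeasurable).symm
    have := hoeffding_abs (μ := Measure.pi fun i => κ i e) (Y := fun i z => f i e (z i))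
      (fun i => (hfe i).comp (measurable_pi_apply i))
      (iIndepFun_pi (X := fun i => f i e) fun i => (hfe i).aemeasurable) hC
      (fun i z => hb i e (z i)) s hε
    simp only [hI] at this
    simpa only [Set.mem_ofPred_eq] using this

/-- Independent variables with an atomless law do not coincide. -/
theorem measure_eq_zero_of_indep [MeasurableSpace Ω] [MeasurableSpace X] [MeasurableEq X]
    {P : Measure Ω} [IsProbabilityMeasure P] {Y Z : Ω → X} (hY : Measurable Y) (hZ : Measurable Z)
    (hi : IndepFun Y Z P) (h0 : ∀ x, P.map Z {x} = 0) : P {ω | Y ω = Z ω} = 0 := by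
  have := (indepFun_iff_map_prod_eq_prod_map_map hY.aemeasurable hZ.aemeasurable).mp hi
  have hd : MeasurableSet (Set.diagonal X) := measurableSet_diagonal
  have h2 : P {ω | Y ω = Z ω} = P.map (fun ω => (Y ω, Z ω)) (Set.diagonal X) := by
    rw [Measure.map_apply (hY.prodMk hZ) hd]; rfl
  have hp : IsProbabilityMeasure (P.map Z) := Measure.isProbabilityMeasure_map hZ.aemeasurable
  rw [h2, this, Measure.prod_apply hd]
  refine (lintegral_congr fun x => ?_).trans lintegral_zero
  rw [← h0 x]
  congr 1
  ext y; simp [eq_comm]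

/-- The rectangle identities which express a conditional law given a sub-`σ`-algebra. -/
theorem measure_inter_eq_of_condExp [Fintype ι] {m : MeasurableSpace Ω} [m0 : MeasurableSpace Ω]
    [MeasurableSpace X] {P : Measure Ω} [IsProbabilityMeasure P] (hm : m ≤ m0)
    {Z : ι → Ω → X} (hZ : ∀ i, Measurable (Z i)) {G : Set Ω} (hG : MeasurableSet[m] G)
    (κ : ι → Kernel[m] Ω X) [∀ i, IsMarkovKernel (κ i)]
    (h : ∀ A : ι → Set X, (∀ i, MeasurableSet (A i)) → ∀ᵐ ω ∂P, ω ∈ G →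
      (P⟦⋂ i, Z i ⁻¹' A i | m⟧) ω = ∏ i, (κ i ω).real (A i))
    (B : Set Ω) (hB : MeasurableSet[m] B) (A : ι → Set X) (hA : ∀ i, MeasurableSet (A i)) :
    P (id ⁻¹' B ∩ (⋂ i, Z i ⁻¹' A i) ∩ G) = ∫⁻ ω in id ⁻¹' B ∩ G, ∏ i, κ i (id ω) (A i) ∂P := by
  have hBG : MeasurableSet[m] (B ∩ G) := hB.inter hG
  have hS : MeasurableSet (⋂ i, Z i ⁻¹' A i) := MeasurableSet.iInter fun i => hZ i (hA i)
  have hprod : ∀ ω, ∏ i, κ i ω (A i) = ENNReal.ofReal (∏ i, (κ i ω).real (A i)) := fun ω => by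
    rw [ENNReal.ofReal_prod_of_nonneg fun i _ => measureReal_nonneg]
    exact Finset.prod_congr rfl fun i _ => (ofReal_measureReal (measure_ne_top _ _)).symm
  have hmeas : Measurable fun ω => ∏ i, (κ i ω).real (A i) :=
    Finset.measurable_prod _ fun i _ =>
      (((κ i).measurable_coe (hA i)).mono hm le_rfl).ennreal_toReal
  have hle : ∀ ω, ∏ i, (κ i ω).real (A i) ≤ 1 := fun ω =>
    Finset.prod_le_one (fun i _ => measureReal_nonneg) fun i _ => measureReal_le_one
  have hnn : ∀ ω, 0 ≤ ∏ i, (κ i ω).real (A i) := fun ω =>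
    Finset.prod_nonneg fun i _ => measureReal_nonneg
  have hint : Integrable (fun ω => ∏ i, (κ i ω).real (A i)) P :=
    Integrable.of_bound hmeas.aestronglyMeasurable 1
      (ae_of_all _ fun ω => by rw [Real.norm_of_nonneg (hnn ω)]; exact hle ω)
  -- Since `B ∩ G` is `m`-measurable, the defining property of conditional expectation applies on
  -- it, and there the product formula is available.
  have h1 : ∫ ω in B ∩ G, ∏ i, (κ i ω).real (A i) ∂P = P.real ((⋂ i, Z i ⁻¹' A i) ∩ (B ∩ G)) := by
    rw [← setIntegral_congr_ae (f := P⟦⋂ i, Z i ⁻¹' A i | m⟧) (hm _ hBG)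
      ((h A hA).mono fun ω hω hω' => hω hω'.2), setIntegral_condExp hm
        ((integrable_const 1).indicator hS) hBG, integral_indicator hS]
    simp [hS, Measure.real, Measure.restrict_apply]
  change P (B ∩ _ ∩ G) = ∫⁻ ω in B ∩ G, ∏ i, κ i ω (A i) ∂P
  simp only [hprod]
  rw [← ofReal_integral_eq_lintegral_ofReal hint.integrableOn (ae_of_all _ hnn), h1,
    ofReal_measureReal]
  congr 1
  ext ω; simp only [Set.mem_inter_iff]; tauto

/-- Borel–Cantelli: a sequence with Gaussian tails on the events `G N` tends to zero almost
surely where eventually all `G N` hold. -/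
theorem ae_tendsto_zero_of_tail [MeasurableSpace Ω] {P : Measure Ω} {D : ℕ → Ω → ℝ}
    {G : ℕ → Set Ω} {a : ℝ} (ha : 0 < a)
    (h : ∀ N, 1 ≤ N → ∀ ε > 0, P ({ω | ε ≤ |D N ω|} ∩ G N) ≤
      ENNReal.ofReal (2 * Real.exp (-(a * ε ^ 2 * N)))) :
    ∀ᵐ ω ∂P, (∀ᶠ N in atTop, ω ∈ G N) → Tendsto (fun N => D N ω) atTop (𝓝 0) := by
  -- Countably many tolerances `1 / (k + 1)` suffice. The shift to `N + 1` avoids `N = 0`, where no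
  -- tail bound is assumed.
  have key : ∀ k : ℕ, ∀ᵐ ω ∂P, ∀ᶠ N in atTop,
      ω ∉ {ω | 1 / ((k : ℝ) + 1) ≤ |D (N + 1) ω|} ∩ G (N + 1) := fun k => by
    refine ae_eventually_notMem (ne_top_of_le_ne_top ?_ (ENNReal.tsum_le_tsum fun N =>
      h (N + 1) (Nat.le_add_left 1 N) (1 / ((k : ℝ) + 1)) Nat.one_div_pos_of_nat))
    have hpos : 0 < a * (1 / ((k : ℝ) + 1)) ^ 2 := by positivity
    have hs : Summable fun N : ℕ =>
        2 * Real.exp (-(a * (1 / ((k : ℝ) + 1)) ^ 2 * ((N + 1 : ℕ) : ℝ))) := by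
      refine Summable.mul_left 2 ?_
      refine (summable_nat_add_iff (f := fun N : ℕ =>
        Real.exp (-(a * (1 / ((k : ℝ) + 1)) ^ 2 * (N : ℝ)))) 1).mpr ((Real.summable_exp_nat_mul_iff.mpr
        (neg_lt_zero.mpr hpos)).congr fun N => ?_)
      congr 1; ring
    exact hs.tsum_ofReal_ne_top
  filter_upwards [ae_all_iff.mpr key] with ω hω hG
  rw [← tendsto_add_atTop_iff_nat 1, Metric.tendsto_atTop']
  intro ε hε
  obtain ⟨k, hk⟩ := exists_nat_one_div_lt hε
  obtain ⟨N₀, hN₀⟩ := eventually_atTop.mp ((hω k).and ((tendsto_add_atTop_nat 1).eventually hG))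
  refine ⟨N₀, fun N hN => ?_⟩
  obtain ⟨h1, h2⟩ := hN₀ N hN.le
  rw [Real.dist_eq, sub_zero]
  by_contra! hcon
  exact h1 ⟨hk.le.trans hcon, h2⟩

end Tools

/-! ### Bounded measurable functions and the limiting recursions -/

section Model

variable {X : Type*} [MeasurableSpace X] {L : ℕ}

/-- Bounded measurable real functions. -/
def IsBddMeas (φ : X → ℝ) : Prop := Measurable φ ∧ ∃ C : ℝ, ∀ x, |φ x| ≤ C

namespace IsBddMeas

variable {φ ψ : X → ℝ}

theorem exists_pos (hφ : IsBddMeas φ) : ∃ C : ℝ, 0 < C ∧ ∀ x, |φ x| ≤ C := by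
  obtain ⟨C, hC⟩ := hφ.2
  exact ⟨max C 1, by positivity, fun x => (hC x).trans (le_max_left _ _)⟩

theorem const (a : ℝ) : IsBddMeas (fun _ : X => a) := ⟨measurable_const, |a|, fun _ => le_rfl⟩

theorem mul (hφ : IsBddMeas φ) (hψ : IsBddMeas ψ) : IsBddMeas (fun x => φ x * ψ x) := by
  obtain ⟨C, hC0, hC⟩ := hφ.exists_pos
  obtain ⟨D, -, hD⟩ := hψ.exists_pos
  refine ⟨hφ.1.mul hψ.1, C * D, fun x => ?_⟩
  rw [abs_mul]
  exact mul_le_mul (hC x) (hD x) (abs_nonneg _) hC0.le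

theorem sub (hφ : IsBddMeas φ) (hψ : IsBddMeas ψ) : IsBddMeas (φ - ψ) := by
  obtain ⟨C, -, hC⟩ := hφ.exists_pos
  obtain ⟨D, -, hD⟩ := hψ.exists_pos
  exact ⟨hφ.1.sub hψ.1, C + D, fun x => (abs_sub _ _).trans (add_le_add (hC x) (hD x))⟩

theorem abs (hφ : IsBddMeas φ) : IsBddMeas (fun x => |φ x|) :=
  ⟨continuous_abs.measurable.comp hφ.1, hφ.2.imp fun C hC x => by rw [abs_abs]; exact hC x⟩

theorem sum {ι : Type*} {s : Finset ι} {f : ι → X → ℝ} (hf : ∀ i ∈ s, IsBddMeas (f i)) :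
    IsBddMeas (fun x => ∑ i ∈ s, f i x) := by
  choose! C hC using fun i hi => (hf i hi).2
  exact ⟨Finset.measurable_sum _ fun i hi => (hf i hi).1, ∑ i ∈ s, C i, fun x =>
    (Finset.abs_sum_le_sum_abs _ _).trans (Finset.sum_le_sum fun i hi => hC i hi x)⟩

theorem integrable (hφ : IsBddMeas φ) (μ : Measure X) [IsFiniteMeasure μ] : Integrable φ μ := by
  obtain ⟨C, hC⟩ := hφ.2
  exact Integrable.of_bound hφ.1.aestronglyMeasurable C (ae_of_all _ hC)

theorem kernelOp (hφ : IsBddMeas φ) (K : Kernel X X) [IsMarkovKernel K] :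
    IsBddMeas (kernelOp K φ) := by
  obtain ⟨C, hC⟩ := hφ.2
  refine ⟨(StronglyMeasurable.integral_kernel hφ.1.stronglyMeasurable).measurable, C, fun x => ?_⟩
  have := norm_integral_le_of_norm_le_const (μ := K x) (f := φ) (C := C) (ae_of_all _ hC)
  simpa [MLBPF.kernelOp] using this

theorem integral_pos (hφ : IsBddMeas φ) (h0 : ∀ x, 0 < φ x) (μ : Measure X)
    [IsProbabilityMeasure μ] : 0 < ∫ x, φ x ∂μ := by
  rw [integral_pos_iff_support_of_nonneg (fun x => (h0 x).le) (hφ.integrable μ)]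
  have : Function.support φ = Set.univ := by ext x; simp [(h0 x).ne']
  simp [this]

end IsBddMeas

theorem levelDiff_isBddMeas {g : Fin (L + 1) → X → ℝ} (hg : ∀ ℓ, IsBddMeas (g ℓ))
    (ℓ : Fin (L + 1)) : IsBddMeas (levelDiff g ℓ) := by
  induction ℓ using Fin.cases with
  | zero => exact hg 0
  | succ k => exact (hg k.succ).sub (hg k.castSucc)

/-- Telescoping; the induction on `L` splits off the top level, and the lower differences are those
of the truncated family. -/
theorem sum_levelDiff {Y : Type*} {L : ℕ} (g : Fin (L + 1) → Y → ℝ) (x : Y) :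
    ∑ ℓ, levelDiff g ℓ x = g (Fin.last L) x := by
  induction L with
  | zero => simp [levelDiff]
  | succ L ih =>
    rw [Fin.sum_univ_castSucc, show Fin.last (L + 1) = (Fin.last L).succ from rfl]
    have h : ∀ i : Fin (L + 1), levelDiff g i.castSucc x =
        levelDiff (fun j => g j.castSucc) i x := fun i => by
      induction i using Fin.cases with
      | zero => rfl
      | succ k => rfl
    simp only [h, ih]
    change g (Fin.last L).castSucc x + (g (Fin.last L).succ x - g (Fin.last L).castSucc x) = _
    ring

theorem isProbabilityMeasure_bayesUpdate (μ : Measure X) [IsProbabilityMeasure μ] {h : X → ℝ}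
    (hh : IsBddMeas h) (h0 : ∀ x, 0 < h x) : IsProbabilityMeasure (bayesUpdate μ h) := by
  have h1 : ∫⁻ x, ENNReal.ofReal (h x) ∂μ = ENNReal.ofReal (∫ x, h x ∂μ) :=
    (ofReal_integral_eq_lintegral_ofReal (hh.integrable μ)
      (ae_of_all _ fun x => (h0 x).le)).symm
  refine ⟨?_⟩
  rw [bayesUpdate, Measure.smul_apply, withDensity_apply _ MeasurableSet.univ,
    Measure.restrict_univ, smul_eq_mul, h1]
  exact ENNReal.inv_mul_cancel (by simpa using hh.integral_pos h0 μ) ENNReal.ofReal_ne_top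

theorem integral_bayesUpdate (μ : Measure X) [IsProbabilityMeasure μ] {h : X → ℝ}
    (hh : IsBddMeas h) (h0 : ∀ x, 0 < h x) (φ : X → ℝ) :
    ∫ x, φ x ∂(bayesUpdate μ h) = (∫ x, h x * φ x ∂μ) / ∫ x, h x ∂μ := by
  have h1 : ∫⁻ x, ENNReal.ofReal (h x) ∂μ = ENNReal.ofReal (∫ x, h x ∂μ) :=
    (ofReal_integral_eq_lintegral_ofReal (hh.integrable μ)
      (ae_of_all _ fun x => (h0 x).le)).symm
  rw [bayesUpdate, integral_smul_measure, h1, integral_withDensity_eq_integral_toReal_smul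
    hh.1.ennreal_ofReal (ae_of_all _ fun x => ENNReal.ofReal_lt_top), ENNReal.toReal_inv,
    ENNReal.toReal_ofReal (hh.integral_pos h0 μ).le, smul_eq_mul, div_eq_inv_mul]
  congr 1
  exact integral_congr_ae (ae_of_all _ fun x => by
    simp [ENNReal.toReal_ofReal (h0 x).le])

/-- Serves twice: with `h = g^L` for the prediction filter, and with `h = ∑ |Δg^ℓ|` for `η`. -/
theorem integral_bayesUpdate_bind (μ : Measure X) [IsProbabilityMeasure μ] {h : X → ℝ}
    (hh : IsBddMeas h) (h0 : ∀ x, 0 < h x) (K : Kernel X X) [IsMarkovKernel K] {φ : X → ℝ}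
    (hφ : IsBddMeas φ) :
    ∫ x, φ x ∂((bayesUpdate μ h).bind K) =
      (∫ x, h x * kernelOp K φ x ∂μ) / ∫ x, h x ∂μ := by
  have := isProbabilityMeasure_bayesUpdate μ hh h0
  rw [← integral_bayesUpdate μ hh h0]
  have hi : Integrable φ ((K ∘ₖ Kernel.const Unit (bayesUpdate μ h)) ()) := hφ.integrable _
  have := Kernel.integral_comp hi
  rwa [Kernel.comp_apply, Kernel.const_apply] at this

theorem isProbabilityMeasure_bayesUpdate_bind (μ : Measure X) [IsProbabilityMeasure μ] {h : X → ℝ}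
    (hh : IsBddMeas h) (h0 : ∀ x, 0 < h x) (K : Kernel X X) [IsMarkovKernel K] :
    IsProbabilityMeasure ((bayesUpdate μ h).bind K) := by
  have := isProbabilityMeasure_bayesUpdate μ hh h0
  infer_instance

/-- Makes `γ_n` linear in the test function, so that the sum over levels can be moved inside the
integral. -/
theorem gamma_eq_mul (π₀ : Measure X) (K : Kernel X X) (g : ℕ → Fin (L + 1) → X → ℝ) (n : ℕ) :
    ∃ a : ℝ, ∀ φ, gamma π₀ K g n φ = a * ∫ x, φ x ∂(predFilter π₀ K g n) := by
  cases n with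
  | zero => exact ⟨1, fun φ => by simp [gamma, predFilter]⟩
  | succ n => exact ⟨_, fun φ => mul_comm _ _⟩

/-- The triangle inequality bounds the sum below by the telescoped sum `g^L`. -/
theorem sum_abs_levelDiff_pos {Y : Type*} {L : ℕ} {g : ℕ → Fin (L + 1) → Y → ℝ}
    (hpos : ∀ n x, 0 < g n (Fin.last L) x) (n : ℕ) (x : Y) :
    0 < ∑ ℓ, |levelDiff (g n) ℓ x| :=
  ((hpos n x).trans_eq (sum_levelDiff (g n) x).symm).trans_le
    ((le_abs_self _).trans (Finset.abs_sum_le_sum_abs _ _))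

variable (π₀ : Measure X) [IsProbabilityMeasure π₀] (K : Kernel X X) [IsMarkovKernel K]
  {g : ℕ → Fin (L + 1) → X → ℝ}

theorem isProbabilityMeasure_predFilter (hg : ∀ n ℓ, IsBddMeas (g n ℓ))
    (hpos : ∀ n x, 0 < g n (Fin.last L) x) (n : ℕ) :
    IsProbabilityMeasure (predFilter π₀ K g n) := by
  induction n with
  | zero => assumption
  | succ n ih => exact isProbabilityMeasure_bayesUpdate_bind _ (hg n _) (hpos n) K

/-- The recursion `γ_{n+1}(φ) = γ̂_n(K φ)`. -/
theorem gamma_succ (hg : ∀ n ℓ, IsBddMeas (g n ℓ)) (hpos : ∀ n x, 0 < g n (Fin.last L) x) (n : ℕ)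
    {φ : X → ℝ} (hφ : IsBddMeas φ) :
    gamma π₀ K g (n + 1) φ =
      gammaUpdate (g n) (gamma π₀ K g n) (eta π₀ K g n) (kernelOp K φ) := by
  have := isProbabilityMeasure_predFilter π₀ K hg hpos n
  obtain ⟨a, ha⟩ := gamma_eq_mul π₀ K g n
  -- After telescoping, the numerators of `γ̂_n(Kφ)` and `γ̂_n(1)` are `a π_n(g_n Kφ)` and `a
  -- π_n(g_n)`; their ratio supplies the factor `π_{n+1}(φ)`.
  have hsum : ∀ {ψ : X → ℝ}, IsBddMeas ψ → ∑ ℓ, gamma π₀ K g n (fun x => levelDiff (g n) ℓ x * ψ x)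
      = a * ∫ x, g n (Fin.last L) x * ψ x ∂(predFilter π₀ K g n) := fun {ψ} hψ => by
    simp only [ha, ← Finset.mul_sum]
    rw [← integral_finsetSum _ fun ℓ _ => ((levelDiff_isBddMeas (hg n) ℓ).mul hψ).integrable _]
    simp only [← Finset.sum_mul, sum_levelDiff]
  have hp := (hg n (Fin.last L)).integral_pos (hpos n) (predFilter π₀ K g n)
  change (∫ x, φ x ∂(bayesUpdate (predFilter π₀ K g n) (g n (Fin.last L))).bind K) * _ = _
  rw [integral_bayesUpdate_bind _ (hg n _) (hpos n) K hφ, gammaUpdate, gammaUpdate,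
    hsum (IsBddMeas.const 1), hsum (hφ.kernelOp K)]
  simp only [mul_one]
  field_simp

/-- `η_n` is integration against a probability measure. -/
theorem exists_measure_eta (hg : ∀ n ℓ, IsBddMeas (g n ℓ))
    (hpos : ∀ n x, 0 < g n (Fin.last L) x) (n : ℕ) :
    ∃ μ : Measure X, IsProbabilityMeasure μ ∧
      ∀ φ, IsBddMeas φ → eta π₀ K g n φ = ∫ x, φ x ∂μ := by
  induction n with
  | zero => exact ⟨π₀, ‹_›, fun φ _ => rfl⟩
  | succ n ih =>
    obtain ⟨μ, hμ, h⟩ := ih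
    have hd : ∀ ℓ, IsBddMeas fun x => |levelDiff (g n) ℓ x| := fun ℓ =>
      (levelDiff_isBddMeas (hg n) ℓ).abs
    have hs : IsBddMeas fun x => ∑ ℓ, |levelDiff (g n) ℓ x| := IsBddMeas.sum fun ℓ _ => hd ℓ
    -- The recursion for `η` is an ordinary prediction filter with likelihood `∑ |Δg^ℓ|`.
    refine ⟨(bayesUpdate μ fun x => ∑ ℓ, |levelDiff (g n) ℓ x|).bind K,
      isProbabilityMeasure_bayesUpdate_bind μ hs (sum_abs_levelDiff_pos hpos n) K, fun φ hφ => ?_⟩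
    rw [integral_bayesUpdate_bind μ hs (sum_abs_levelDiff_pos hpos n) K hφ]
    simp only [eta, etaUpdate, Finset.sum_mul]
    rw [integral_finsetSum _ fun ℓ _ => ((hd ℓ).mul (hφ.kernelOp K)).integrable _,
      integral_finsetSum _ fun ℓ _ => (hd ℓ).integrable _]
    simp only [h _ (hd _), h _ ((hd _).mul (hφ.kernelOp K))]

/-- Permits division by the limit of `∑ |w̃^j|`, and forces this sum to be positive for all large
`N`. -/
theorem sum_eta_abs_levelDiff_pos (hg : ∀ n ℓ, IsBddMeas (g n ℓ))
    (hpos : ∀ n x, 0 < g n (Fin.last L) x) (n : ℕ) :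
    0 < ∑ ℓ, eta π₀ K g n fun x => |levelDiff (g n) ℓ x| := by
  obtain ⟨μ, hμ, h⟩ := exists_measure_eta π₀ K hg hpos n
  have hd : ∀ ℓ, IsBddMeas fun x => |levelDiff (g n) ℓ x| := fun ℓ =>
    (levelDiff_isBddMeas (hg n) ℓ).abs
  simp only [h _ (hd _)]
  rw [← integral_finsetSum _ fun ℓ _ => (hd ℓ).integrable _]
  exact (IsBddMeas.sum fun ℓ _ => hd ℓ).integral_pos (sum_abs_levelDiff_pos hpos n) μ

end Model

/-! ### Transfer to conditional laws given a sub-σ-algebra -/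

section CondExp

variable {Ω X ι : Type*} [Fintype ι] {m : MeasurableSpace Ω} [m0 : MeasurableSpace Ω]
  [MeasurableSpace X] {P : Measure Ω} [IsProbabilityMeasure P]

/-- Hoeffding's inequality when the conditional law given a sub-`σ`-algebra is a product on `G`. -/
theorem hoeffding_of_condExp (hm : m ≤ m0)
    {Z : ι → Ω → X} (hZ : ∀ i, Measurable (Z i)) {G : Set Ω} (hG : MeasurableSet[m] G)
    (κ : ι → Kernel[m] Ω X) [∀ i, IsMarkovKernel (κ i)]
    (h : ∀ A : ι → Set X, (∀ i, MeasurableSet (A i)) → ∀ᵐ ω ∂P, ω ∈ G →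
      (P⟦⋂ i, Z i ⁻¹' A i | m⟧) ω = ∏ i, (κ i ω).real (A i))
    {f : ι → Ω → X → ℝ} (hf : ∀ i, Measurable[m.prod inferInstance] fun p : Ω × X => f i p.1 p.2)
    {C : ℝ} (hC : 0 < C) (hb : ∀ i ω x, |f i ω x| ≤ C) (s : Finset ι) {ε : ℝ} (hε : 0 ≤ ε) :
    P ({ω | ε * s.card ≤ |∑ i ∈ s, (f i ω (Z i ω) - ∫ x, f i ω x ∂(κ i ω))|} ∩ G) ≤
      ENNReal.ofReal (2 * Real.exp (-(ε ^ 2 * s.card / (2 * C ^ 2)))) :=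
  -- The past is encoded by `H = id`, from `Ω` with `m0` to `Ω` with the smaller σ-algebra `m`.
  @hoeffding_of_pi Ω Ω X ι _ m0 m _ P _ id (measurable_id'' hm) Z hZ G κ _
    (measure_inter_eq_of_condExp hm hZ hG κ h) f hf C hC hb s ε hε

/-- Conditionally independent variables with atomless conditional laws do not coincide. -/
theorem ae_injective_of_condExp [MeasurableEq X] (hm : m ≤ m0)
    {Z : ι → Ω → X} (hZ : ∀ i, Measurable (Z i))
    (κ : ι → Kernel[m] Ω X) [∀ i, IsMarkovKernel (κ i)] (hκ : ∀ i ω x, κ i ω {x} = 0)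
    (h : ∀ A : ι → Set X, (∀ i, MeasurableSet (A i)) → ∀ᵐ ω ∂P,
      (P⟦⋂ i, Z i ⁻¹' A i | m⟧) ω = ∏ i, (κ i ω).real (A i)) :
    ∀ᵐ ω ∂P, Function.Injective fun i => Z i ω := by
  have key : ∀ i j, i ≠ j → ∀ᵐ ω ∂P, Z i ω ≠ Z j ω := fun i j hij => by
    have := @measure_le_of_pi_le Ω Ω X ι _ m0 m _ P _ id (measurable_id'' hm) Z hZ Set.univ κ _
      (measure_inter_eq_of_condExp hm hZ MeasurableSet.univ κ
        fun A hA => (h A hA).mono fun ω hω _ => hω)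
      {p | p.2 i = p.2 j} (@measurableSet_eq_fun _ _ (m.prod _) _ _ _ _
        ((measurable_pi_apply i).comp measurable_snd) ((measurable_pi_apply j).comp measurable_snd))
      0 ?_
    · rw [ae_iff]
      simpa using this
    · intro ω
      have hpr : ∀ i, IsProbabilityMeasure (κ i ω) := fun i =>
        (‹∀ i, @IsMarkovKernel _ _ m _ (κ i)› i).isProbabilityMeasure ω
      refine (measure_eq_zero_of_indep (P := Measure.pi fun i => κ i ω) (measurable_pi_apply i)
        (measurable_pi_apply j)
        ((iIndepFun_pi (μ := fun i => κ i ω) (X := fun i => id)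
          fun i => aemeasurable_id).indepFun hij) ?_).le
      have hp := (measurePreserving_eval (fun i => κ i ω) j).map_eq
      intro x
      exact (congrArg (fun ν : Measure X => ν {x}) hp).trans (hκ j ω x)
  have hall : ∀ᵐ ω ∂P, ∀ i j, i ≠ j → Z i ω ≠ Z j ω :=
    ae_all_iff.mpr fun i => ae_all_iff.mpr fun j => by
      by_cases hij : i = j
      · exact ae_of_all _ fun ω h => (h hij).elim
      · exact (key i j hij).mono fun ω h _ => h
  exact hall.mono fun ω hω i j hij => by_contra fun hne => hω i j hne hij

end CondExp

/-! ### Signs, weights and the total variation of discrete measures -/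

section Deterministic

variable {X : Type*} [MeasurableSpace X] {L : ℕ} {c : Fin (L + 1) → ℕ} {N : ℕ}

theorem abs_sign_le_one (r : ℝ) : |Real.sign r| ≤ 1 := by
  rcases Real.sign_apply_eq r with h | h | h <;> simp [h]

theorem measurable_sign : Measurable Real.sign := by
  unfold Real.sign
  exact Measurable.ite measurableSet_Iio measurable_const
    (Measurable.ite measurableSet_Ioi measurable_const measurable_const)

theorem sign_nonneg_of_nonneg {r : ℝ} (hr : 0 ≤ r) : 0 ≤ Real.sign r := by
  rcases hr.eq_or_lt with h | h
  · simp [← h]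
  · simp [Real.sign_of_pos h]

theorem abs_mul_sign (r : ℝ) : |r| * Real.sign r = r := by
  rcases lt_trichotomy r 0 with h | h | h
  · rw [Real.sign_of_neg h, abs_of_neg h]; ring
  · simp [h]
  · rw [Real.sign_of_pos h, abs_of_pos h]; ring

/-- Resampling reproduces the signs of the weights if positions do not coincide or the weights
are nonnegative. -/
theorem abs_mul_sign_weightAt {Y : Type*} {x : Idx c N → Y} {v : Idx c N → ℝ}
    (h : Function.Injective x ∨ ∀ i, 0 ≤ v i) (j : Idx c N) :
    |v j| * Real.sign (weightAt x v (x j)) = v j := by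
  rcases h with h | h
  · have : weightAt x v (x j) = v j := by
      rw [weightAt, Finset.sum_eq_single j]
      · simp
      · intro i _ hij
        exact Set.indicator_of_notMem (fun h' => hij (h h'.symm)) _
      · simp
    rw [this, abs_mul_sign]
  -- With nonnegative weights, coinciding positions can only increase the total weight at `x j`, so
  -- its sign is still right; if `v j = 0` both sides vanish.
  · rcases (h j).eq_or_lt with h0 | h0
    · simp [← h0]
    · have : v j ≤ weightAt x v (x j) := by
        refine le_trans ?_ (Finset.single_le_sum (f := fun i =>
          Set.indicator {x i} (fun _ => v i) (x j))
          (fun i _ => Set.indicator_nonneg (fun _ _ => h i) _) (Finset.mem_univ j))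
        simp
      rw [Real.sign_of_pos (h0.trans_le this), mul_one, abs_of_pos h0]

theorem abs_weight_le_one {Y : Type*} (g : ℕ → Fin (L + 1) → Y → ℝ) (x y : ℕ → Idx c N → Y)
    (n : ℕ) (i : Idx c N) : |weight g x y n i| ≤ 1 := by
  cases n with
  | zero => simp [weight]
  | succ n => exact abs_sign_le_one _

theorem weight_nonneg {Y : Type*} {g : ℕ → Fin (L + 1) → Y → ℝ}
    (hg : ∀ n ℓ x, 0 ≤ levelDiff (g n) ℓ x) (x y : ℕ → Idx c N → Y) (n : ℕ) :
    ∀ i, 0 ≤ weight g x y n i := by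
  induction n with
  | zero => exact fun i => zero_le_one
  | succ n ih =>
    exact fun i => sign_nonneg_of_nonneg (Finset.sum_nonneg fun j _ =>
      Set.indicator_nonneg (fun _ _ => mul_nonneg (mul_nonneg (by positivity) (hg _ _ _)) (ih j)) _)

theorem tildeWeight_nonneg {Y : Type*} {g : ℕ → Fin (L + 1) → Y → ℝ}
    (hg : ∀ n ℓ x, 0 ≤ levelDiff (g n) ℓ x) (x y : ℕ → Idx c N → Y) (n : ℕ) (i : Idx c N) :
    0 ≤ tildeWeight g x y n i :=
  mul_nonneg (mul_nonneg (by positivity) (hg _ _ _)) (weight_nonneg hg x y n i)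

/-- The total variation of a discrete signed measure with distinct atoms or nonnegative weights. -/
theorem totalVariation_sum_dirac [MeasurableSingletonClass X] {κ : Type*} [Fintype κ]
    {x : κ → X} {a : κ → ℝ} (h : Function.Injective x ∨ ∀ k, 0 ≤ a k) :
    (∑ k, a k • (Measure.dirac (x k)).toSignedMeasure).totalVariation =
      ∑ k, ENNReal.ofReal |a k| • Measure.dirac (x k) := by
  -- `p` and `q` collect the positive and negative parts of the coefficients; once they are mutually
  -- singular, uniqueness of the Jordan decomposition identifies the total variation as `p + q`.
  let p : Measure X := ∑ k, ENNReal.ofReal (a k) • Measure.dirac (x k)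
  let q : Measure X := ∑ k, ENNReal.ofReal (-a k) • Measure.dirac (x k)
  have hp : ∀ S, MeasurableSet S →
      p S = ∑ k, ENNReal.ofReal (a k) * S.indicator 1 (x k) := fun S hS => by
    simp [p, hS]
  have hq : ∀ S, MeasurableSet S →
      q S = ∑ k, ENNReal.ofReal (-a k) * S.indicator 1 (x k) := fun S hS => by
    simp [q, hS]
  have hi : ∀ (S : Set X) k, S.indicator (1 : X → ENNReal) (x k) ≠ ⊤ := fun S k => by
    by_cases hk : x k ∈ S <;> simp [hk]
  have hpf : IsFiniteMeasure p := ⟨by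
    rw [hp _ MeasurableSet.univ]
    exact ENNReal.sum_lt_top.mpr fun k _ =>
      (ENNReal.mul_ne_top ENNReal.ofReal_ne_top (hi _ _)).lt_top⟩
  have hqf : IsFiniteMeasure q := ⟨by
    rw [hq _ MeasurableSet.univ]
    exact ENNReal.sum_lt_top.mpr fun k _ =>
      (ENNReal.mul_ne_top ENNReal.ofReal_ne_top (hi _ _)).lt_top⟩
  have hpq : p ⟂ₘ q := by
    -- The finite set of atoms with positive coefficient separates `p` from `q`. Injectivity
    -- excludes that an atom of `q` lies at the same point; with nonnegative coefficients `q = 0`.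
    have hfin : (x '' {k | 0 < a k}).Finite := Set.toFinite _
    refine Measure.MutuallySingular.symm ⟨x '' {k | 0 < a k}, hfin.measurableSet, ?_, ?_⟩
    · rw [hq _ hfin.measurableSet]
      refine Finset.sum_eq_zero fun k _ => ?_
      rcases h with h | h
      · by_cases hk : 0 < a k
        · simp [ENNReal.ofReal_of_nonpos (neg_nonpos.mpr hk.le)]
        · rw [Set.indicator_of_notMem, mul_zero]
          rintro ⟨k', hk', hkk⟩
          exact hk (h hkk ▸ hk')
      · simp [ENNReal.ofReal_of_nonpos (neg_nonpos.mpr (h k))]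
    · rw [hp _ hfin.measurableSet.compl]
      refine Finset.sum_eq_zero fun k _ => ?_
      by_cases hk : 0 < a k
      · rw [Set.indicator_of_notMem, mul_zero]
        exact fun hc => hc ⟨k, hk, rfl⟩
      · simp [ENNReal.ofReal_of_nonpos (not_lt.mp hk)]
  let j : JordanDecomposition X :=
    { posPart := p, negPart := q, mutuallySingular := hpq }
  have hj : ∑ k, a k • (Measure.dirac (x k)).toSignedMeasure = j.toSignedMeasure := by
    ext S hS
    have hdirac : ∀ k, (Measure.dirac (x k)).real S = (S.indicator (1 : X → ENNReal) (x k)).toReal :=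
      fun k => by simp [Measure.real, hS]
    rw [JordanDecomposition.toSignedMeasure, sub_apply,
      Measure.toSignedMeasure_apply_measurable hS, Measure.toSignedMeasure_apply_measurable hS]
    change _ = p.real S - q.real S
    rw [Measure.real, Measure.real, hp S hS, hq S hS,
      ENNReal.toReal_sum fun k _ => ENNReal.mul_ne_top ENNReal.ofReal_ne_top (hi _ _),
      ENNReal.toReal_sum fun k _ => ENNReal.mul_ne_top ENNReal.ofReal_ne_top (hi _ _),
      ← Finset.sum_sub_distrib]
    have : (∑ k, a k • (Measure.dirac (x k)).toSignedMeasure) S =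
        ∑ k, a k * (Measure.dirac (x k)).real S := by
      rw [← FunLike.coeAddMonoidHom_apply, map_sum, Finset.sum_apply]
      refine Finset.sum_congr rfl fun k _ => ?_
      rw [FunLike.coeAddMonoidHom_apply, smul_apply,
        Measure.toSignedMeasure_apply_measurable hS, smul_eq_mul]
    rw [this]
    refine Finset.sum_congr rfl fun k _ => ?_
    rw [hdirac, ENNReal.toReal_mul, ENNReal.toReal_mul, ENNReal.toReal_ofReal',
      ENNReal.toReal_ofReal', ← sub_mul, max_zero_sub_max_neg_zero_eq_self]
  rw [SignedMeasure.totalVariation, hj, JordanDecomposition.toJordanDecomposition_toSignedMeasure]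
  change p + q = _
  rw [← Finset.sum_add_distrib]
  refine Finset.sum_congr rfl fun k _ => ?_
  rw [← add_smul]
  congr 1
  rcases le_total 0 (a k) with hk | hk
  · rw [abs_of_nonneg hk, ENNReal.ofReal_of_nonpos (neg_nonpos.mpr hk), add_zero]
  · rw [abs_of_nonpos hk, ENNReal.ofReal_of_nonpos hk, zero_add]

theorem empAbsGamma_eq [MeasurableSingletonClass X] {x : Idx c N → X} {w : Idx c N → ℝ}
    (h : Function.Injective x ∨ ∀ i, 0 ≤ w i) (ℓ : Fin (L + 1)) (φ : X → ℝ) :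
    empAbsGamma x w ℓ φ =
      ((c ℓ * N : ℕ) : ℝ)⁻¹ * ∑ k : Fin (c ℓ * N), |w ⟨ℓ, k⟩| * φ (x ⟨ℓ, k⟩) := by
  have hr : (0 : ℝ) ≤ ((c ℓ * N : ℕ) : ℝ)⁻¹ := by positivity
  have h' : (Function.Injective fun k : Fin (c ℓ * N) => x ⟨ℓ, k⟩) ∨
      ∀ k : Fin (c ℓ * N), 0 ≤ ((c ℓ * N : ℕ) : ℝ)⁻¹ * w ⟨ℓ, k⟩ :=
    h.imp (fun h => h.comp sigma_mk_injective) fun h k => mul_nonneg hr (h _)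
  rw [empAbsGamma, empSigned, Finset.smul_sum]
  simp only [smul_smul]
  rw [totalVariation_sum_dirac h', integral_finsetSum_measure fun k _ => ?_, Finset.mul_sum]
  · refine Finset.sum_congr rfl fun k _ => ?_
    rw [integral_smul_measure, integral_dirac, ENNReal.toReal_ofReal (abs_nonneg _), abs_mul,
      abs_of_nonneg hr, smul_eq_mul, mul_assoc]
  · exact (integrable_dirac (by simp)).smul_measure ENNReal.ofReal_ne_top

end Deterministic

/-! ### Measurability and concentration for one run -/

section Run

variable {Ω X : Type*} [MeasurableSpace X] {L : ℕ} {c : Fin (L + 1) → ℕ} {N : ℕ}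

/-- The weights `w_n^i` along a random trajectory. -/
abbrev runWeight (g : ℕ → Fin (L + 1) → X → ℝ) (ξ ξh : ℕ → Idx c N → Ω → X) (n : ℕ) (ω : Ω) :
    Idx c N → ℝ :=
  weight g (fun q i => ξ q i ω) (fun q i => ξh q i ω) n

/-- The weights `w̃_n^i` along a random trajectory. -/
abbrev runTilde (g : ℕ → Fin (L + 1) → X → ℝ) (ξ ξh : ℕ → Idx c N → Ω → X) (n : ℕ) (ω : Ω) :
    Idx c N → ℝ :=
  tildeWeight g (fun q i => ξ q i ω) (fun q i => ξh q i ω) n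

/-- Each indicator tests an equality of two random points, which is where measurability of the
diagonal is needed. -/
theorem measurable_weightAt [mΩ : MeasurableSpace Ω] [MeasurableEq X] {x : Idx c N → Ω → X}
    {v : Idx c N → Ω → ℝ} {y : Ω → X} (hx : ∀ i, Measurable (x i)) (hv : ∀ i, Measurable (v i))
    (hy : Measurable y) :
    Measurable fun ω => weightAt (fun i => x i ω) (fun i => v i ω) (y ω) := by
  classical
  refine Finset.measurable_sum _ fun i _ => ?_
  have : (fun ω => Set.indicator {x i ω} (fun _ => v i ω) (y ω)) =
      fun ω => if y ω = x i ω then v i ω else 0 := by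
    ext ω; simp [Set.indicator_apply]
  rw [this]
  exact Measurable.ite (measurableSet_eq_fun hy (hx i)) (hv i) measurable_const

theorem measurable_updatedWeight [mΩ : MeasurableSpace Ω] {g : Fin (L + 1) → X → ℝ}
    (hg : ∀ ℓ, IsBddMeas (g ℓ)) {x : Idx c N → Ω → X} {w : Idx c N → Ω → ℝ}
    (hx : ∀ i, Measurable (x i)) (hw : ∀ i, Measurable (w i)) (i : Idx c N) :
    Measurable fun ω => updatedWeight g (fun i => x i ω) (fun i => w i ω) i :=
  (((levelDiff_isBddMeas hg i.1).1.comp (hx i)).const_mul _).mul (hw i)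

/-- The weights at time `n` depend only on strictly earlier positions. The σ-algebra on `Ω` is left
arbitrary so that the history can be inserted. -/
theorem measurable_runWeight [mΩ : MeasurableSpace Ω] [MeasurableEq X]
    {g : ℕ → Fin (L + 1) → X → ℝ} (hg : ∀ n ℓ, IsBddMeas (g n ℓ)) {ξ ξh : ℕ → Idx c N → Ω → X}
    (n : ℕ) (h1 : ∀ q < n, ∀ i, Measurable (ξ q i)) (h2 : ∀ p < n, ∀ i, Measurable (ξh p i)) :
    ∀ i, Measurable fun ω => runWeight g ξ ξh n ω i := by
  induction n with
  | zero => exact fun i => measurable_const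
  | succ n ih =>
    intro i
    exact measurable_sign.comp (measurable_weightAt (h1 n n.lt_succ_self)
      (measurable_updatedWeight (hg n) (h1 n n.lt_succ_self)
        (ih (fun q hq => h1 q (hq.trans n.lt_succ_self)) fun p hp => h2 p (hp.trans n.lt_succ_self)))
      (h2 n n.lt_succ_self i))

theorem measurable_runTilde [mΩ : MeasurableSpace Ω] [MeasurableEq X]
    {g : ℕ → Fin (L + 1) → X → ℝ} (hg : ∀ n ℓ, IsBddMeas (g n ℓ)) {ξ ξh : ℕ → Idx c N → Ω → X}
    (n : ℕ) (h1 : ∀ q ≤ n, ∀ i, Measurable (ξ q i)) (h2 : ∀ p < n, ∀ i, Measurable (ξh p i)) :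
    ∀ i, Measurable fun ω => runTilde g ξ ξh n ω i :=
  measurable_updatedWeight (hg n) (h1 n le_rfl)
    (measurable_runWeight hg n (fun q hq => h1 q hq.le) h2)

theorem measurable_history (ξ ξh : ℕ → Idx c N → Ω → X) {n q : ℕ} (hq : q ≤ n) (i : Idx c N) :
    Measurable[history ξ ξh n] (ξ q i) :=
  (comap_measurable (ξ q i)).mono (le_sup_of_le_left (le_iSup₂_of_le q hq
    (le_iSup (fun i => MeasurableSpace.comap (ξ q i) inferInstance) i))) le_rfl

theorem measurable_history_hat (ξ ξh : ℕ → Idx c N → Ω → X) {n p : ℕ} (hp : p < n) (i : Idx c N) :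
    Measurable[history ξ ξh n] (ξh p i) :=
  (comap_measurable (ξh p i)).mono (le_sup_of_le_right (le_iSup₂_of_le p hp
    (le_iSup (fun i => MeasurableSpace.comap (ξh p i) inferInstance) i))) le_rfl

theorem measurable_historyHat (ξ ξh : ℕ → Idx c N → Ω → X) {n q : ℕ} (hq : q ≤ n) (i : Idx c N) :
    Measurable[historyHat ξ ξh n] (ξ q i) :=
  (comap_measurable (ξ q i)).mono (le_sup_of_le_left (le_iSup₂_of_le q hq
    (le_iSup (fun i => MeasurableSpace.comap (ξ q i) inferInstance) i))) le_rfl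

theorem measurable_historyHat_hat (ξ ξh : ℕ → Idx c N → Ω → X) {n p : ℕ} (hp : p ≤ n)
    (i : Idx c N) : Measurable[historyHat ξ ξh n] (ξh p i) :=
  (comap_measurable (ξh p i)).mono (le_sup_of_le_right (le_iSup₂_of_le p hp
    (le_iSup (fun i => MeasurableSpace.comap (ξh p i) inferInstance) i))) le_rfl

/-- The law `∑_j |v^j| δ_{x^j} / ∑_j |v^j|`, completed by `π₀` where `v` vanishes. -/
def resampleLaw {ι : Type*} [Fintype ι] (π₀ : Measure X) (x : ι → X) (v : ι → ℝ) : Measure X :=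
  if 0 < ∑ j, |v j| then ∑ j, ENNReal.ofReal (|v j| / ∑ j, |v j|) • Measure.dirac (x j) else π₀

theorem isProbabilityMeasure_resampleLaw {ι : Type*} [Fintype ι] (π₀ : Measure X)
    [IsProbabilityMeasure π₀] (x : ι → X) (v : ι → ℝ) :
    IsProbabilityMeasure (resampleLaw π₀ x v) := by
  unfold resampleLaw
  split_ifs with h
  · refine ⟨?_⟩
    simp only [Measure.coe_finsetSum, Measure.coe_smul, Finset.sum_apply, Pi.smul_apply,
      measure_univ, smul_eq_mul, mul_one]
    rw [← ENNReal.ofReal_sum_of_nonneg fun j _ => by positivity, ← Finset.sum_div,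
      div_self h.ne', ENNReal.ofReal_one]
  · assumption

theorem integral_resampleLaw {ι : Type*} [Fintype ι] [MeasurableSingletonClass X]
    (π₀ : Measure X) (x : ι → X) {v : ι → ℝ} (h : 0 < ∑ j, |v j|) (f : X → ℝ) :
    ∫ y, f y ∂(resampleLaw π₀ x v) = (∑ j, |v j| * f (x j)) / ∑ j, |v j| := by
  rw [resampleLaw, if_pos h, integral_finsetSum_measure fun j _ =>
    (integrable_dirac (by simp)).smul_measure ENNReal.ofReal_ne_top, Finset.sum_div]
  refine Finset.sum_congr rfl fun j _ => ?_
  rw [integral_smul_measure, integral_dirac, ENNReal.toReal_ofReal (by positivity), smul_eq_mul]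
  ring

theorem measurable_resampleLaw {ι : Type*} [Fintype ι] [mΩ : MeasurableSpace Ω] (π₀ : Measure X)
    {x : ι → Ω → X} {v : ι → Ω → ℝ} (hx : ∀ i, Measurable (x i)) (hv : ∀ i, Measurable (v i)) :
    Measurable fun ω => resampleLaw π₀ (fun i => x i ω) (fun i => v i ω) := by
  have habs : ∀ i, Measurable fun ω => |v i ω| := fun i => continuous_abs.measurable.comp (hv i)
  have hS : Measurable fun ω => ∑ j, |v j ω| := Finset.measurable_sum _ fun j _ => habs j
  unfold resampleLaw
  refine Measurable.ite (measurableSet_lt measurable_const hS) ?_ measurable_const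
  refine Measure.measurable_of_measurable_coe _ fun A hA => ?_
  simp only [Measure.coe_finsetSum, Measure.coe_smul, Finset.sum_apply, Pi.smul_apply, smul_eq_mul]
  exact Finset.measurable_sum _ fun j _ => ((habs j).div hS).ennreal_ofReal.mul
    (((Measure.measurable_coe hA).comp Measure.measurable_dirac).comp (hx j))

variable [mΩ : MeasurableSpace Ω] {P : Measure Ω} {π₀ : Measure X} {K : Kernel X X}
  {g : ℕ → Fin (L + 1) → X → ℝ} {ξ ξh : ℕ → Idx c N → Ω → X}

namespace IsRun

theorem history_le (h : IsRun P π₀ K g ξ ξh) (n : ℕ) : history ξ ξh n ≤ mΩ :=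
  sup_le (iSup₂_le fun q _ => iSup_le fun i => (h.measurable_particle q i).comap_le)
    (iSup₂_le fun q _ => iSup_le fun i => (h.measurable_resampled q i).comap_le)

theorem historyHat_le (h : IsRun P π₀ K g ξ ξh) (n : ℕ) : historyHat ξ ξh n ≤ mΩ :=
  sup_le (iSup₂_le fun q _ => iSup_le fun i => (h.measurable_particle q i).comap_le)
    (iSup₂_le fun q _ => iSup_le fun i => (h.measurable_resampled q i).comap_le)

/-- Concentration of the resampling step. -/
theorem resample_tail [MeasurableEq X] [IsProbabilityMeasure P] [IsProbabilityMeasure π₀]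
    (h : IsRun P π₀ K g ξ ξh) (hg : ∀ n ℓ, IsBddMeas (g n ℓ)) {T : ℝ → ℝ} (hT : Measurable T)
    (hT1 : ∀ r, |T r| ≤ |r|) {ψ : X → ℝ} (hψ : Measurable ψ) {C : ℝ} (hC : 0 < C)
    (hb : ∀ x, |ψ x| ≤ C) (n : ℕ) (s : Finset (Idx c N)) {ε : ℝ} (hε : 0 ≤ ε) :
    P ({ω | ε * s.card ≤ |∑ i ∈ s, (T (runWeight g ξ ξh (n + 1) ω i) * ψ (ξh n i ω) -
        (∑ j, |runTilde g ξ ξh n ω j| *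
          (T (Real.sign (weightAt (fun i => ξ n i ω) (runTilde g ξ ξh n ω) (ξ n j ω))) *
            ψ (ξ n j ω))) / ∑ j, |runTilde g ξ ξh n ω j|)|} ∩
        {ω | 0 < ∑ j, |runTilde g ξ ξh n ω j|}) ≤
      ENNReal.ofReal (2 * Real.exp (-(ε ^ 2 * s.card / (2 * C ^ 2)))) := by
  have hξm := fun i => measurable_history ξ ξh (le_refl n) i
  have htm := measurable_runTilde (mΩ := history ξ ξh n) hg n
    (fun q hq => measurable_history ξ ξh hq) (fun p hp => measurable_history_hat ξ ξh hp)
  -- The value `π₀` of `resampleLaw` at vanishing weights only serves to make `κ` Markov everywhere;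
  -- the estimate is restricted to the event that the total weight is positive.
  let κ : Idx c N → Kernel[history ξ ξh n] Ω X := fun _ =>
    @Kernel.mk Ω X (history ξ ξh n) _
      (fun ω => resampleLaw π₀ (fun i => ξ n i ω) (runTilde g ξ ξh n ω))
      (measurable_resampleLaw (mΩ := history ξ ξh n) π₀ hξm htm)
  have hκ : ∀ i, @IsMarkovKernel Ω X (history ξ ξh n) _ (κ i) := fun i =>
    @IsMarkovKernel.mk Ω X (history ξ ξh n) _ (κ i)
      fun ω => isProbabilityMeasure_resampleLaw π₀ _ _
  have hSm : Measurable[history ξ ξh n] fun ω => ∑ j, |runTilde g ξ ξh n ω j| :=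
    Finset.measurable_sum _ fun j _ => continuous_abs.measurable.comp (htm j)
  have hG : MeasurableSet[history ξ ξh n] {ω | 0 < ∑ j, |runTilde g ξ ξh n ω j|} :=
    hSm measurableSet_Ioi
  have hcond : ∀ A : Idx c N → Set X, (∀ i, MeasurableSet (A i)) → ∀ᵐ ω ∂P,
      ω ∈ {ω | 0 < ∑ j, |runTilde g ξ ξh n ω j|} →
      (P⟦⋂ i, ξh n i ⁻¹' A i | history ξ ξh n⟧) ω = ∏ i, (κ i ω).real (A i) := fun A hA => by
    filter_upwards [h.resample n A hA] with ω hω hωG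
    rw [hω hωG]
    refine Finset.prod_congr rfl fun i _ => ?_
    rw [← integral_resampleLaw π₀ (fun i => ξ n i ω) hωG]
    exact integral_indicator_one (hA i)
  -- The new weight is a function of the past and of the resampled point itself, so it belongs to
  -- the integrand rather than to the conditioning.
  have hf : Measurable[(history ξ ξh n).prod inferInstance] fun p : Ω × X =>
      T (Real.sign (weightAt (fun i => ξ n i p.1) (runTilde g ξ ξh n p.1) p.2)) * ψ p.2 :=
    (hT.comp (measurable_sign.comp (measurable_weightAt
      (mΩ := (history ξ ξh n).prod inferInstance) (fun i => (hξm i).comp measurable_fst)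
        (fun i => (htm i).comp measurable_fst) measurable_snd))).mul (hψ.comp measurable_snd)
  refine (measure_mono ?_).trans (@hoeffding_of_condExp _ _ _ _ (history ξ ξh n) _ _ P _
    (h.history_le n) _ (h.measurable_resampled n) _ hG κ hκ hcond (fun _ ω y =>
      T (Real.sign (weightAt (fun i => ξ n i ω) (runTilde g ξ ξh n ω) y)) * ψ y)
    (fun _ => hf) C hC (fun _ ω y => ?_) s ε hε)
  · rintro ω ⟨hω, hωG⟩
    refine ⟨?_, hωG⟩
    have : ∀ i, ∫ y, T (Real.sign (weightAt (fun i => ξ n i ω) (runTilde g ξ ξh n ω) y)) * ψ y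
        ∂(κ i ω) = _ := fun i => integral_resampleLaw π₀ (fun i => ξ n i ω) hωG _
    simp only [Set.mem_ofPred_eq, this]
    exact hω
  · rw [abs_mul, ← one_mul C]
    exact mul_le_mul ((hT1 _).trans (abs_sign_le_one _)) (hb y) (abs_nonneg _) zero_le_one

/-- Concentration of the mutation step. -/
theorem mutate_tail [MeasurableEq X] [IsProbabilityMeasure P] [IsMarkovKernel K]
    (h : IsRun P π₀ K g ξ ξh) (hg : ∀ n ℓ, IsBddMeas (g n ℓ)) {T : ℝ → ℝ} (hT : Measurable T)
    (hT1 : ∀ r, |T r| ≤ |r|) {φ : X → ℝ} (hφ : Measurable φ) {C : ℝ} (hC : 0 < C)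
    (hb : ∀ x, |φ x| ≤ C) (n : ℕ) (s : Finset (Idx c N)) {ε : ℝ} (hε : 0 ≤ ε) :
    P ({ω | ε * s.card ≤ |∑ i ∈ s, (T (runWeight g ξ ξh (n + 1) ω i) * φ (ξ (n + 1) i ω) -
        T (runWeight g ξ ξh (n + 1) ω i) * kernelOp K φ (ξh n i ω))|} ∩ Set.univ) ≤
      ENNReal.ofReal (2 * Real.exp (-(ε ^ 2 * s.card / (2 * C ^ 2)))) := by
  -- Unlike in resampling, the weight at time `n + 1` is already known before mutation and acts as a
  -- constant factor.
  have hwm := measurable_runWeight (mΩ := historyHat ξ ξh n) hg (n + 1)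
    (fun q hq => measurable_historyHat ξ ξh (Nat.lt_succ_iff.mp hq))
    (fun p hp => measurable_historyHat_hat ξ ξh (Nat.lt_succ_iff.mp hp))
  let κ : Idx c N → Kernel[historyHat ξ ξh n] Ω X := fun i =>
    @Kernel.mk Ω X (historyHat ξ ξh n) _ (fun ω => K (ξh n i ω))
      (K.measurable.comp (measurable_historyHat_hat ξ ξh le_rfl i))
  have hκ : ∀ i, @IsMarkovKernel Ω X (historyHat ξ ξh n) _ (κ i) := fun i =>
    @IsMarkovKernel.mk Ω X (historyHat ξ ξh n) _ (κ i)
      fun ω => (‹IsMarkovKernel K›).isProbabilityMeasure (ξh n i ω)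
  have hf : ∀ i, Measurable[(historyHat ξ ξh n).prod inferInstance] fun p : Ω × X =>
      T (runWeight g ξ ξh (n + 1) p.1 i) * φ p.2 := fun i =>
    (hT.comp ((hwm i).comp measurable_fst)).mul (hφ.comp measurable_snd)
  refine (measure_mono ?_).trans (hoeffding_of_condExp (h.historyHat_le n)
    (h.measurable_particle (n + 1)) MeasurableSet.univ κ
    (fun A hA => (h.mutate n A hA).mono fun ω hω _ => hω)
    (f := fun i ω y => T (runWeight g ξ ξh (n + 1) ω i) * φ y)
    hf hC (fun i ω y => ?_) s hε)
  · rintro ω ⟨hω, -⟩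
    refine ⟨?_, trivial⟩
    have : ∀ i, ∫ y, T (runWeight g ξ ξh (n + 1) ω i) * φ y ∂(κ i ω) =
        T (runWeight g ξ ξh (n + 1) ω i) * kernelOp K φ (ξh n i ω) := fun i =>
      integral_const_mul _ _
    simp only [Set.mem_ofPred_eq, this]
    exact hω
  · rw [abs_mul, ← one_mul C]
    exact mul_le_mul ((hT1 _).trans (abs_weight_le_one _ _ _ _ _)) (hb y) (abs_nonneg _) zero_le_one

/-- Particles do not coincide if the initial law and the kernel are atomless. -/
theorem ae_injective [MeasurableEq X] [IsProbabilityMeasure P] [IsMarkovKernel K]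
    (h : IsRun P π₀ K g ξ ξh) (h0 : ∀ x, π₀ {x} = 0) (hK : ∀ x y, K x {y} = 0) (n : ℕ) :
    ∀ᵐ ω ∂P, Function.Injective fun i => ξ n i ω := by
  cases n with
  | zero =>
    have key : ∀ i j, i ≠ j → ∀ᵐ ω ∂P, ξ 0 i ω ≠ ξ 0 j ω := fun i j hij => by
      rw [ae_iff]
      simpa using measure_eq_zero_of_indep (h.measurable_particle 0 i) (h.measurable_particle 0 j)
        (h.init_indep.indepFun hij) (by rw [h.init_law j]; exact h0)
    have hall : ∀ᵐ ω ∂P, ∀ i j, i ≠ j → ξ 0 i ω ≠ ξ 0 j ω :=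
      ae_all_iff.mpr fun i => ae_all_iff.mpr fun j => by
        by_cases hij : i = j
        · exact ae_of_all _ fun ω h => (h hij).elim
        · exact (key i j hij).mono fun ω h _ => h
    exact hall.mono fun ω hω i j hij => by_contra fun hne => hω i j hne hij
  | succ n =>
    let κ : Idx c N → Kernel[historyHat ξ ξh n] Ω X := fun i =>
      @Kernel.mk Ω X (historyHat ξ ξh n) _ (fun ω => K (ξh n i ω))
        (K.measurable.comp (measurable_historyHat_hat ξ ξh le_rfl i))
    have hκ : ∀ i, @IsMarkovKernel Ω X (historyHat ξ ξh n) _ (κ i) := fun i =>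
      @IsMarkovKernel.mk Ω X (historyHat ξ ξh n) _ (κ i)
        fun ω => (‹IsMarkovKernel K›).isProbabilityMeasure (ξh n i ω)
    exact ae_injective_of_condExp (h.historyHat_le n) (h.measurable_particle (n + 1)) κ
      (fun i ω x => hK _ x) fun A hA => h.mutate n A hA

end IsRun

end Run

/-! ### Almost sure limits by induction on time -/

section Limit

variable {Ω X : Type*} [MeasurableSpace X] [mΩ : MeasurableSpace Ω] {P : Measure Ω} {L : ℕ}
  {c : Fin (L + 1) → ℕ}

/-- Sub-Gaussian block sums have block means which tend to zero almost surely. -/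
theorem ae_tendsto_blockMean (hc : ∀ ℓ, 1 ≤ c ℓ) {F : (N : ℕ) → Idx c N → Ω → ℝ}
    {G : ℕ → Set Ω} {C : ℝ} (hC : 0 < C)
    (h : ∀ N, 1 ≤ N → ∀ s : Finset (Idx c N), ∀ ε : ℝ, 0 ≤ ε →
      P ({ω | ε * s.card ≤ |∑ i ∈ s, F N i ω|} ∩ G N) ≤
        ENNReal.ofReal (2 * Real.exp (-(ε ^ 2 * s.card / (2 * C ^ 2))))) (ℓ : Fin (L + 1)) :
    ∀ᵐ ω ∂P, (∀ᶠ N in atTop, ω ∈ G N) →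
      Tendsto (fun N => ((c ℓ * N : ℕ) : ℝ)⁻¹ * ∑ k : Fin (c ℓ * N), F N ⟨ℓ, k⟩ ω)
        atTop (𝓝 0) := by
  refine ae_tendsto_zero_of_tail (a := 1 / (2 * C ^ 2)) (by positivity) fun N hN ε hε => ?_
  -- As `c ℓ ≥ 1`, a block has at least `N` elements, so its tail is dominated by one in `N`.
  have hcard : (1 : ℝ) * N ≤ ((c ℓ * N : ℕ) : ℝ) := by
    push_cast
    exact mul_le_mul_of_nonneg_right (by exact_mod_cast hc ℓ) (by positivity)
  have hpos : (0 : ℝ) < ((c ℓ * N : ℕ) : ℝ) := by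
    have : (1 : ℝ) ≤ N := by exact_mod_cast hN
    linarith
  have hs := h N hN (Finset.univ.map (Function.Embedding.sigmaMk ℓ)) ε hε.le
  simp only [Finset.card_map, Finset.card_univ, Fintype.card_fin, Finset.sum_map,
    Function.Embedding.sigmaMk_apply] at hs
  refine (measure_mono ?_).trans (hs.trans (ENNReal.ofReal_le_ofReal ?_))
  · rintro ω ⟨hω, hG⟩
    refine ⟨?_, hG⟩
    simp only [Set.mem_ofPred_eq] at hω ⊢
    rw [abs_mul, abs_of_pos (inv_pos.mpr hpos), ← div_eq_inv_mul, le_div_iff₀ hpos] at hω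
    exact hω
  · refine mul_le_mul_of_nonneg_left (Real.exp_le_exp.mpr (neg_le_neg ?_)) zero_le_two
    rw [div_mul_eq_mul_div, one_mul, div_mul_eq_mul_div]
    exact div_le_div_of_nonneg_right
      (mul_le_mul_of_nonneg_left (by linarith) (by positivity)) (by positivity)

/-- The strong law for the initial particles. -/
theorem ae_tendsto_init [IsProbabilityMeasure P] {π₀ : Measure X} [IsProbabilityMeasure π₀]
    {K : Kernel X X} {g : ℕ → Fin (L + 1) → X → ℝ} (hc : ∀ ℓ, 1 ≤ c ℓ)
    {ξ ξh : (N : ℕ) → ℕ → Idx c N → Ω → X}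
    (h_run : ∀ N, 1 ≤ N → IsRun P π₀ K g (ξ N) (ξh N)) {φ : X → ℝ} (hφ : IsBddMeas φ)
    (ℓ : Fin (L + 1)) :
    ∀ᵐ ω ∂P, Tendsto (fun N => ((c ℓ * N : ℕ) : ℝ)⁻¹ *
      ∑ k : Fin (c ℓ * N), φ (ξ N 0 ⟨ℓ, k⟩ ω)) atTop (𝓝 (∫ x, φ x ∂π₀)) := by
  obtain ⟨C, hC, hb⟩ := hφ.exists_pos
  have := ae_tendsto_blockMean (P := P) hc (F := fun N i ω => φ (ξ N 0 i ω) - ∫ x, φ x ∂π₀)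
    (G := fun _ => Set.univ) hC (fun N hN s ε hε => ?_) ℓ
  · filter_upwards [this] with ω hω
    have h1 := (hω (Eventually.of_forall fun _ => trivial)).add_const (∫ x, φ x ∂π₀)
    rw [zero_add] at h1
    refine h1.congr' ?_
    filter_upwards [eventually_ge_atTop 1] with N hN
    have hpos : ((c ℓ * N : ℕ) : ℝ) ≠ 0 :=
      Nat.cast_ne_zero.mpr (Nat.mul_pos (hc ℓ) hN).ne'
    rw [Finset.sum_sub_distrib, mul_sub, Finset.sum_const, Finset.card_univ, Fintype.card_fin,
      nsmul_eq_mul, inv_mul_cancel_left₀ hpos, sub_add_cancel]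
  · have hr := h_run N hN
    have hI : ∀ i, ∫ ω, φ (ξ N 0 i ω) ∂P = ∫ x, φ x ∂π₀ := fun i => by
      conv_rhs => rw [← hr.init_law i]
      exact (integral_map (hr.measurable_particle 0 i).aemeasurable
        hφ.1.aestronglyMeasurable).symm
    have := hoeffding_abs (Y := fun i ω => φ (ξ N 0 i ω))
      (fun i => hφ.1.comp (hr.measurable_particle 0 i))
      (hr.init_indep.comp (fun _ => φ) fun _ => hφ.1) hC (fun i ω => hb _) s hε
    simp only [hI] at this
    rwa [Set.inter_univ]

/-- One resampling and mutation step of the strong law, for the weights (`T = id`) and their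
absolute values (`T = |·|`). -/
theorem ae_tendsto_step [MeasurableEq X] [IsProbabilityMeasure P] {π₀ : Measure X}
    [IsProbabilityMeasure π₀] {K : Kernel X X} [IsMarkovKernel K] {g : ℕ → Fin (L + 1) → X → ℝ}
    (hg : ∀ n ℓ, IsBddMeas (g n ℓ)) (hc : ∀ ℓ, 1 ≤ c ℓ) {ξ ξh : (N : ℕ) → ℕ → Idx c N → Ω → X}
    (h_run : ∀ N, 1 ≤ N → IsRun P π₀ K g (ξ N) (ξh N)) {T : ℝ → ℝ} (hT : Measurable T)
    (hT1 : ∀ r, |T r| ≤ |r|) (hT2 : ∀ a b, 0 ≤ a → T (a * b) = a * T b) {φ : X → ℝ}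
    (hφ : IsBddMeas φ) {n : ℕ}
    (hnd : ∀ᵐ ω ∂P, ∀ N, 1 ≤ N → (Function.Injective fun i => ξ N n i ω) ∨
      ∀ i, 0 ≤ runTilde g (ξ N) (ξh N) n ω i)
    {A D : ℝ} (hD : 0 < D)
    (hA : ∀ᵐ ω ∂P, Tendsto (fun N => ∑ j, T (runTilde g (ξ N) (ξh N) n ω j) *
      kernelOp K φ (ξ N n j ω)) atTop (𝓝 A))
    (hS : ∀ᵐ ω ∂P, Tendsto (fun N => ∑ j, |runTilde g (ξ N) (ξh N) n ω j|) atTop (𝓝 D))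
    (ℓ : Fin (L + 1)) :
    ∀ᵐ ω ∂P, Tendsto (fun N => ((c ℓ * N : ℕ) : ℝ)⁻¹ * ∑ k : Fin (c ℓ * N),
      T (runWeight g (ξ N) (ξh N) (n + 1) ω ⟨ℓ, k⟩) * φ (ξ N (n + 1) ⟨ℓ, k⟩ ω))
        atTop (𝓝 (A / D)) := by
  obtain ⟨C, hC, hb⟩ := hφ.exists_pos
  have hψ := hφ.kernelOp K
  obtain ⟨C', hC', hb'⟩ := hψ.exists_pos
  have h1 := ae_tendsto_blockMean (P := P) hc hC' (fun N hN s ε hε =>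
    (h_run N hN).resample_tail hg hT hT1 hψ.1 hC' hb' n s hε) ℓ
  have h2 := ae_tendsto_blockMean (P := P) hc hC (fun N hN s ε hε =>
    (h_run N hN).mutate_tail hg hT hT1 hφ.1 hC hb n s hε) ℓ
  filter_upwards [h1, h2, hnd, hA, hS] with ω h1 h2 hnd hA hS
  -- The block mean is the resampling error plus the mutation error plus the ratio of weighted sums.
  -- Convergence of the total weight to `D > 0` puts `ω` eventually in the events of the resampling
  -- bound.
  have h3 := ((h1 (hS.eventually_const_lt hD)).add
    (h2 (Eventually.of_forall fun _ => trivial))).add (hA.div hS hD.ne')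
  rw [zero_add, zero_add] at h3
  refine h3.congr' ?_
  filter_upwards [eventually_ge_atTop 1] with N hN
  have hpos : ((c ℓ * N : ℕ) : ℝ) ≠ 0 :=
    Nat.cast_ne_zero.mpr (Nat.mul_pos (hc ℓ) hN).ne'
  -- Pulling the nonnegative factor `|w̃^j|` into `T` leaves `T (|w̃^j| sgn w̃(ξ^j)) = T (w̃^j)`.
  have hsgn : ∀ j, |runTilde g (ξ N) (ξh N) n ω j| *
      (T (Real.sign (weightAt (fun i => ξ N n i ω) (runTilde g (ξ N) (ξh N) n ω) (ξ N n j ω))) *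
        kernelOp K φ (ξ N n j ω)) =
      T (runTilde g (ξ N) (ξh N) n ω j) * kernelOp K φ (ξ N n j ω) := fun j => by
    rw [← mul_assoc, ← hT2 _ _ (abs_nonneg _),
      abs_mul_sign_weightAt (x := fun i => ξ N n i ω) (hnd N hN) j]
  simp only [hsgn, Pi.div_apply]
  rw [Finset.sum_sub_distrib, Finset.sum_sub_distrib, mul_sub, mul_sub, Finset.sum_const,
    Finset.card_univ, Fintype.card_fin, nsmul_eq_mul, inv_mul_cancel_left₀ hpos]
  ring

/-- The normalised sums over all particles, sorted by levels. -/
theorem sum_tilde_eq {Y : Type*} {N : ℕ} {T : ℝ → ℝ} (hT2 : ∀ a b, 0 ≤ a → T (a * b) = a * T b)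
    (hT3 : ∀ a b, T (a * b) = T a * T b) (g : ℕ → Fin (L + 1) → Y → ℝ) (x y : ℕ → Idx c N → Y)
    (n : ℕ) (ψ : Y → ℝ) :
    ∑ j, T (tildeWeight g x y n j) * ψ (x n j) =
      ∑ ℓ, ((c ℓ * N : ℕ) : ℝ)⁻¹ * ∑ k : Fin (c ℓ * N), T (weight g x y n ⟨ℓ, k⟩) *
        (T (levelDiff (g n) ℓ (x n ⟨ℓ, k⟩)) * ψ (x n ⟨ℓ, k⟩)) := by
  rw [Fintype.sum_sigma]
  refine Finset.sum_congr rfl fun ℓ _ => ?_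
  rw [Finset.mul_sum]
  refine Finset.sum_congr rfl fun k _ => ?_
  rw [tildeWeight, updatedWeight, mul_assoc, hT2 _ _ (by positivity), hT3]
  ring

/-- Almost sure convergence of the weighted empirical means and of their absolute versions. -/
theorem ae_tendsto_empirical [MeasurableEq X] [IsProbabilityMeasure P] {π₀ : Measure X}
    [IsProbabilityMeasure π₀] {K : Kernel X X} [IsMarkovKernel K] {g : ℕ → Fin (L + 1) → X → ℝ}
    (hg : ∀ n ℓ, IsBddMeas (g n ℓ)) (hpos : ∀ n x, 0 < g n (Fin.last L) x) (hc : ∀ ℓ, 1 ≤ c ℓ)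
    {ξ ξh : (N : ℕ) → ℕ → Idx c N → Ω → X}
    (h_run : ∀ N, 1 ≤ N → IsRun P π₀ K g (ξ N) (ξh N))
    (hnd : ∀ n, ∀ᵐ ω ∂P, ∀ N, 1 ≤ N → (Function.Injective fun i => ξ N n i ω) ∨
      ∀ i, 0 ≤ runTilde g (ξ N) (ξh N) n ω i) (n : ℕ) :
    ∀ (ℓ : Fin (L + 1)) (φ : X → ℝ), IsBddMeas φ →
    (∀ᵐ ω ∂P, Tendsto (fun N => ((c ℓ * N : ℕ) : ℝ)⁻¹ * ∑ k : Fin (c ℓ * N),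
      runWeight g (ξ N) (ξh N) n ω ⟨ℓ, k⟩ * φ (ξ N n ⟨ℓ, k⟩ ω))
        atTop (𝓝 (gamma π₀ K g n φ))) ∧
    (∀ᵐ ω ∂P, Tendsto (fun N => ((c ℓ * N : ℕ) : ℝ)⁻¹ * ∑ k : Fin (c ℓ * N),
      |runWeight g (ξ N) (ξh N) n ω ⟨ℓ, k⟩| * φ (ξ N n ⟨ℓ, k⟩ ω))
        atTop (𝓝 (eta π₀ K g n φ))) := by
  induction n with
  | zero =>
    intro ℓ φ hφ
    have := ae_tendsto_init hc h_run hφ ℓ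
    simp only [runWeight, weight, abs_one, one_mul]
    exact ⟨this, this⟩
  | succ n ih =>
    intro ℓ φ hφ
    have hd := fun ℓ => levelDiff_isBddMeas (hg n) ℓ
    have hγ : ∀ ψ, IsBddMeas ψ → ∀ᵐ ω ∂P, Tendsto (fun N =>
        ∑ j, id (runTilde g (ξ N) (ξh N) n ω j) * ψ (ξ N n j ω)) atTop
          (𝓝 (∑ ℓ, gamma π₀ K g n fun x => levelDiff (g n) ℓ x * ψ x)) := fun ψ hψ => by
      filter_upwards [ae_all_iff.mpr fun ℓ => (ih ℓ _ ((hd ℓ).mul hψ)).1] with ω hω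
      refine (tendsto_finsetSum _ fun ℓ _ => hω ℓ).congr fun N => ?_
      exact (sum_tilde_eq (T := id) (fun _ _ _ => rfl) (fun _ _ => rfl) g
        (fun q i => ξ N q i ω) (fun q i => ξh N q i ω) n ψ).symm
    have hη : ∀ ψ, IsBddMeas ψ → ∀ᵐ ω ∂P, Tendsto (fun N =>
        ∑ j, |runTilde g (ξ N) (ξh N) n ω j| * ψ (ξ N n j ω)) atTop
          (𝓝 (∑ ℓ, eta π₀ K g n fun x => |levelDiff (g n) ℓ x| * ψ x)) := fun ψ hψ => by
      filter_upwards [ae_all_iff.mpr fun ℓ => (ih ℓ _ ((hd ℓ).abs.mul hψ)).2] with ω hω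
      refine (tendsto_finsetSum _ fun ℓ _ => hω ℓ).congr fun N => ?_
      exact (sum_tilde_eq (T := abs) (fun a b ha => by rw [abs_mul, abs_of_nonneg ha])
        abs_mul g (fun q i => ξ N q i ω) (fun q i => ξh N q i ω) n ψ).symm
    have hS : ∀ᵐ ω ∂P, Tendsto (fun N => ∑ j, |runTilde g (ξ N) (ξh N) n ω j|) atTop
        (𝓝 (∑ ℓ, eta π₀ K g n fun x => |levelDiff (g n) ℓ x|)) := by
      simpa only [mul_one] using hη _ (IsBddMeas.const 1)
    have hD := sum_eta_abs_levelDiff_pos π₀ K hg hpos n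
    rw [gamma_succ π₀ K hg hpos n hφ]
    exact ⟨ae_tendsto_step hg hc h_run (T := id) measurable_id (fun _ => le_rfl)
        (fun _ _ _ => rfl) hφ (hnd n) hD (hγ _ (hφ.kernelOp K)) hS ℓ,
      ae_tendsto_step hg hc h_run (T := abs) continuous_abs.measurable (fun r => (abs_abs r).le)
        (fun a b ha => by rw [abs_mul, abs_of_nonneg ha]) hφ (hnd n) hD
        (hη _ (hφ.kernelOp K)) hS ℓ⟩

end Limit

end MLBPF

end

theorem proposition1 {X Ω : Type*} [MeasurableSpace X] [MeasurableEq X] [MeasurableSpace Ω]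
    (P : Measure Ω) [IsProbabilityMeasure P]
    (π₀ : Measure X) [IsProbabilityMeasure π₀] (K : Kernel X X) [IsMarkovKernel K]
    (L : ℕ) (g : ℕ → Fin (L + 1) → X → ℝ)
    (hg_meas : ∀ n ℓ, Measurable (g n ℓ))
    (hg_bdd : ∀ n ℓ, ∃ C : ℝ, ∀ x, |g n ℓ x| ≤ C)
    (hg_pos : ∀ n x, 0 < g n (Fin.last L) x)
    (h_coincide : ((∀ x, π₀ {x} = 0) ∧ ∀ x y, K x {y} = 0) ∨
      ∀ n ℓ x, 0 ≤ MLBPF.levelDiff (g n) ℓ x)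
    (c : Fin (L + 1) → ℕ) (hc : ∀ ℓ, 1 ≤ c ℓ)
    (ξ ξh : (N : ℕ) → ℕ → MLBPF.Idx c N → Ω → X)
    (h_run : ∀ N, 1 ≤ N → MLBPF.IsRun P π₀ K g (ξ N) (ξh N))
    (n : ℕ) (ℓ : Fin (L + 1)) (φ : X → ℝ) (hφ : Measurable φ) (hφ_bdd : ∃ C : ℝ, ∀ x, |φ x| ≤ C) :
    (∀ᵐ ω ∂P, Tendsto
      (fun N => MLBPF.empGamma (fun i => ξ N n i ω)
        (MLBPF.weight g (fun q i => ξ N q i ω) (fun q i => ξh N q i ω) n) ℓ φ)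
      atTop (𝓝 (MLBPF.gamma π₀ K g n φ))) ∧
    (∀ᵐ ω ∂P, Tendsto
      (fun N => MLBPF.empAbsGamma (fun i => ξ N n i ω)
        (MLBPF.weight g (fun q i => ξ N q i ω) (fun q i => ξh N q i ω) n) ℓ φ)
      atTop (𝓝 (MLBPF.eta π₀ K g n φ))) := by
  have hg : ∀ n ℓ, MLBPF.IsBddMeas (g n ℓ) := fun n ℓ => ⟨hg_meas n ℓ, hg_bdd n ℓ⟩
  have hinj : ((∀ x, π₀ {x} = 0) ∧ ∀ x y, K x {y} = 0) → ∀ n, ∀ᵐ ω ∂P, ∀ N, 1 ≤ N →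
      Function.Injective fun i => ξ N n i ω := fun h n =>
    ae_all_iff.mpr fun N => by
      by_cases hN : 1 ≤ N
      · exact ((h_run N hN).ae_injective h.1 h.2 n).mono fun ω hω _ => hω
      · exact ae_of_all _ fun ω h' => (hN h').elim
  have hnd : ∀ n, ∀ᵐ ω ∂P, ∀ N, 1 ≤ N → (Function.Injective fun i => ξ N n i ω) ∨
      ∀ i, 0 ≤ MLBPF.runTilde g (ξ N) (ξh N) n ω i := fun n => by
    rcases h_coincide with h | h
    · exact (hinj h n).mono fun ω hω N hN => Or.inl (hω N hN)
    · exact ae_of_all _ fun ω N _ => Or.inr (MLBPF.tildeWeight_nonneg h _ _ n)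
  -- Resampling needs the dichotomy for `w̃_n`, while the total variation of the empirical measure
  -- needs it for `w_n`.
  have hw : ∀ᵐ ω ∂P, ∀ N, 1 ≤ N → (Function.Injective fun i => ξ N n i ω) ∨
      ∀ i, 0 ≤ MLBPF.runWeight g (ξ N) (ξh N) n ω i := by
    rcases h_coincide with h | h
    · exact (hinj h n).mono fun ω hω N hN => Or.inl (hω N hN)
    · exact ae_of_all _ fun ω N _ => Or.inr (MLBPF.weight_nonneg h _ _ n)
  have key := MLBPF.ae_tendsto_empirical hg hg_pos hc h_run hnd n ℓ φ ⟨hφ, hφ_bdd⟩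
  refine ⟨key.1, ?_⟩
  filter_upwards [key.2, hw] with ω hω hwω
  refine hω.congr' ?_
  filter_upwards [eventually_ge_atTop 1] with N hN
  exact (MLBPF.empAbsGamma_eq (hwω N hN) ℓ φ).symm
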